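/- Let $n,m$ be dimensions, $T>0$, and write $\mathbb S^k$ for the symmetric real $k\times k$ matrices. Following the source, $L^\infty(0,T;\mathbb H)$ denotes the (necessarily bounded) continuous $\mathbb H$-valued functions on $[0,T]$. Let $A,\widetilde A,C,\widetilde C\in L^\infty(0,T;\mathbb R^{n\times n})$, $B,\widetilde B,D,\widetilde D,S,\widetilde S\in L^\infty(0,T;\mathbb R^{n\times m})$, $Q,\widetilde Q\in L^\infty(0,T;\mathbb S^n)$, $R,\widetilde R\in L^\infty(0,T;\mathbb S^m)$ and $G,\widetilde G\in\mathbb S^n$ (no definiteness is assumed). These are the coefficients of the mean-field linear-quadratic problem of minimizing, over square-integrable $\mathbb F$-progressively measurable $u$ with values in $\mathbb R^m$ (where $\mathbb F$ is the augmented filtration of a one-dimensional Brownian motion $W$), $$\mathbb E\Big\{\int_0^T\big[\langle QX,X\rangle+\langle\widetilde Q\,\mathbb EX,\mathbb EX\rangle+2\langle Su,X\rangle+2\langle\widetilde S\,\mathbb Eu,\mathbb EX\rangle+\langle Ru,u\rangle+\langle\widetilde R\,\mathbb Eu,\mathbb Eu\rangle\big]dt+\langle GX(T),X(T)\rangle+\langle\widetilde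 G\,\mathbb EX(T),\mathbb EX(T)\rangle\Big\}$$ subject to $dX=(AX+\widetilde A\,\mathbb EX+Bu+\widetilde B\,\mathbb Eu)\,dt+(CX+\widetilde C\,\mathbb EX+Du+\widetilde D\,\mathbb Eu)\,dW$, $X(0)=x$. Put $\widehat A=A+\widetilde A$, and similarly $\widehat B,\widehat C,\widehat D,\widehat Q,\widehat S,\widehat R,\widehat G$. For a symmetric-matrix-valued function $f$ on $[0,T]$, $f\ge 0$ means that $f(t)$ is positive semidefinite for a.e. $t\in[0,T]$, and $f\gg0$ means that $f-\delta I\ge0$ for some constant $\delta>0$. Let $\Lambda[0,T]$ be the set of $\mathbb S^n$-valued functions $F(t)=F(0)+\int_0^t f(s)\,ds$, $t\in[0,T]$, with $f=\dot F\in L^\infty(0,T;\mathbb S^n)$. For $H,K\in\Lambda[0,T]$ put $$\begin{aligned}Q^{H,K}&=\dot H+HA+A^\top H+C^\top HC+Q,&\widehat Q^{H,K}&=\dot K+K\widehat A+\widehat A^\top K+\widehat C^\top H\widehat C+\widehat Q,\\ S^{H,K}&=HB+C^\top HD+S,&\widehat S^{H,K}&=K\widehat B+\widehat C^\top H\widehat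 D+\widehat S,\\ R^{H,K}&=D^\top HD+R,&\widehat R^{H,K}&=\widehat D^\top H\widehat D+\widehat R,\\ G^{H,K}&=G-H(T),&\widehat G^{H,K}&=\widehat G-K(T),\end{aligned}$$ and let $\mathbf Q^{H,K},\mathbf S^{H,K},\mathbf R^{H,K},\mathbf G^{H,K}$ be the block-diagonal matrices $\mathrm{diag}(Q^{H,K},\widehat Q^{H,K})$, $\mathrm{diag}(S^{H,K},\widehat S^{H,K})$, $\mathrm{diag}(R^{H,K},\widehat R^{H,K})$, $\mathrm{diag}(G^{H,K},\widehat G^{H,K})$. The pair $(H,K)\in\Lambda[0,T]\times\Lambda[0,T]$ is called a relaxed compensator if $$\begin{pmatrix}\mathbf Q^{H,K}&\mathbf S^{H,K}\\(\mathbf S^{H,K})^\top&\mathbf R^{H,K}\end{pmatrix}\ge0,\qquad \mathbf R^{H,K}\gg0,\qquad \mathbf G^{H,K}\ge0 .$$ Then a relaxed compensator exists if and only if the system of Riccati equations $$\begin{cases}\dot P+PA+A^\top P+C^\top PC+Q-\Gamma(P)^\top[D^\top PD+R]\,\Gamma(P)=0\ \text{ on }[0,T],\\ P(T)=G,\qquad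 D^\top PD+R\gg0,\end{cases}$$ $$\begin{cases}\dot{\widehat P}+\widehat P\widehat A+\widehat A^\top\widehat P+\widehat C^\top P\widehat C+\widehat Q-\widehat\Gamma(P,\widehat P)^\top[\widehat D^\top P\widehat D+\widehat R]\,\widehat\Gamma(P,\widehat P)=0\ \text{ on }[0,T],\\ \widehat P(T)=\widehat G,\qquad \widehat D^\top P\widehat D+\widehat R\gg0,\end{cases}$$ where $$\Gamma(P)=-[D^\top PD+R]^{-1}[PB+C^\top PD+S]^\top,\qquad \widehat\Gamma(P,\widehat P)=-[\widehat D^\top P\widehat D+\widehat R]^{-1}[\widehat P\widehat B+\widehat C^\top P\widehat D+\widehat S]^\top,$$ has a unique pair of solutions $(P,\widehat P)$ on $[0,T]$, with $P,\widehat P\in C^1([0,T];\mathbb S^n)$. -/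

import Mathlib

namespace MFLQ

open MeasureTheory Matrix

/-- `MemLInf T φ`: the matrix-valued function `φ` belongs to `L^∞(0,T;ℍ)`, the space of continuous
functions on `[0,T]` with finite essential supremum (finiteness of the essential supremum is
automatic for a continuous function on the compact interval `[0,T]`). -/
def MemLInf {ι κ : Type*} (T : ℝ) (φ : ℝ → Matrix ι κ ℝ) : Prop :=
  ContinuousOn φ (Set.Icc 0 T)

/-- `MemLInfSymm T φ`: `φ` belongs to `L^∞(0,T;𝕊ⁿ)`. -/
def MemLInfSymm {ι : Type*} (T : ℝ) (φ : ℝ → Matrix ι ι ℝ) : Prop :=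
  MemLInf T φ ∧ ∀ t ∈ Set.Icc 0 T, (φ t).IsSymm

/-- The data of the mean-field linear-quadratic problem with state dimension `n` and control
dimension `m`: horizon `T > 0`, coefficients `A, Ã, B, B̃, C, C̃, D, D̃` of the state equation
`dX = (AX + Ã𝔼X + Bu + B̃𝔼u) dt + (CX + C̃𝔼X + Du + D̃𝔼u) dW`, and weights
`Q, Q̃, S, S̃, R, R̃, G, G̃` of the cost functional. No definiteness is assumed. -/
structure Data (n m : ℕ) where
  T : ℝ
  T_pos : 0 < T
  A : ℝ → Matrix (Fin n) (Fin n) ℝ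
  A' : ℝ → Matrix (Fin n) (Fin n) ℝ
  B : ℝ → Matrix (Fin n) (Fin m) ℝ
  B' : ℝ → Matrix (Fin n) (Fin m) ℝ
  C : ℝ → Matrix (Fin n) (Fin n) ℝ
  C' : ℝ → Matrix (Fin n) (Fin n) ℝ
  D : ℝ → Matrix (Fin n) (Fin m) ℝ
  D' : ℝ → Matrix (Fin n) (Fin m) ℝ
  Q : ℝ → Matrix (Fin n) (Fin n) ℝ
  Q' : ℝ → Matrix (Fin n) (Fin n) ℝ
  S : ℝ → Matrix (Fin n) (Fin m) ℝ
  S' : ℝ → Matrix (Fin n) (Fin m) ℝ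
  R : ℝ → Matrix (Fin m) (Fin m) ℝ
  R' : ℝ → Matrix (Fin m) (Fin m) ℝ
  G : Matrix (Fin n) (Fin n) ℝ
  G' : Matrix (Fin n) (Fin n) ℝ
  memA : MemLInf T A
  memA' : MemLInf T A'
  memB : MemLInf T B
  memB' : MemLInf T B'
  memC : MemLInf T C
  memC' : MemLInf T C'
  memD : MemLInf T D
  memD' : MemLInf T D'
  memQ : MemLInfSymm T Q
  memQ' : MemLInfSymm T Q'
  memS : MemLInf T S
  memS' : MemLInf T S'
  memR : MemLInfSymm T R
  memR' : MemLInfSymm T R'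
  symmG : G.IsSymm
  symmG' : G'.IsSymm

namespace Data

variable {n m : ℕ} (d : Data n m)

/-- `Â = A + Ã`, and likewise for the other hatted coefficients. -/
def hatA (t : ℝ) : Matrix (Fin n) (Fin n) ℝ := d.A t + d.A' t
def hatB (t : ℝ) : Matrix (Fin n) (Fin m) ℝ := d.B t + d.B' t
def hatC (t : ℝ) : Matrix (Fin n) (Fin n) ℝ := d.C t + d.C' t
def hatD (t : ℝ) : Matrix (Fin n) (Fin m) ℝ := d.D t + d.D' t
def hatQ (t : ℝ) : Matrix (Fin n) (Fin n) ℝ := d.Q t + d.Q' t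
def hatS (t : ℝ) : Matrix (Fin n) (Fin m) ℝ := d.S t + d.S' t
def hatR (t : ℝ) : Matrix (Fin m) (Fin m) ℝ := d.R t + d.R' t
def hatG : Matrix (Fin n) (Fin n) ℝ := d.G + d.G'

end Data

/-- `f(·) ≥ 0` on `[0,T]`: positive semidefinite for almost every `t`. -/
def Nonneg {ι : Type*} [Fintype ι] (T : ℝ) (f : ℝ → Matrix ι ι ℝ) : Prop :=
  ∀ᵐ t ∂(volume.restrict (Set.Icc 0 T)), (f t).PosSemidef

/-- `f(·) ≫ 0` on `[0,T]`: there is `δ > 0` with `f(·) - δ I ≥ 0`. -/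
def UnifPos {ι : Type*} [Fintype ι] [DecidableEq ι] (T : ℝ) (f : ℝ → Matrix ι ι ℝ) : Prop :=
  ∃ δ : ℝ, 0 < δ ∧ Nonneg T (fun t => f t - δ • (1 : Matrix ι ι ℝ))

/-- Condition (PD) for a quadruple `(𝐐(·), 𝐒(·), 𝐑(·), 𝐆)`. -/
def ConditionPD {ι κ : Type*} [Fintype ι] [Fintype κ] [DecidableEq κ] (T : ℝ)
    (Q : ℝ → Matrix ι ι ℝ) (S : ℝ → Matrix ι κ ℝ) (R : ℝ → Matrix κ κ ℝ)
    (G : Matrix ι ι ℝ) : Prop :=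
  Nonneg T (fun t => fromBlocks (Q t) (S t) (S t)ᵀ (R t)) ∧ UnifPos T R ∧ G.PosSemidef

/-- `MemLambda T F f`: `F` belongs to `Λ[0,T]` with density `f = Ḟ`, that is, `F` is
`𝕊ⁿ`-valued, `f ∈ L^∞(0,T;𝕊ⁿ)` and `F(t) = F(0) + ∫₀ᵗ f(s) ds` on `[0,T]` (the integral of a matrix
is taken entry by entry). -/
def MemLambda {n : ℕ} (T : ℝ) (F f : ℝ → Matrix (Fin n) (Fin n) ℝ) : Prop :=
  MemLInfSymm T f ∧ (∀ t ∈ Set.Icc 0 T, (F t).IsSymm) ∧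
    ∀ t ∈ Set.Icc 0 T, F t = F 0 + of fun i j => ∫ s in (0 : ℝ)..t, f s i j

/-- `MemC1 T F f`: `F` belongs to `C¹([0,T];𝕊ⁿ)` with derivative `f = Ḟ` (entry by
entry, one-sided at the endpoints). -/
def MemC1 {n : ℕ} (T : ℝ) (F f : ℝ → Matrix (Fin n) (Fin n) ℝ) : Prop :=
  (∀ t ∈ Set.Icc 0 T, (F t).IsSymm) ∧ ContinuousOn f (Set.Icc 0 T) ∧
    ∀ t ∈ Set.Icc 0 T, ∀ i j,
      HasDerivWithinAt (fun s => F s i j) (f t i j) (Set.Icc 0 T) t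

namespace Data

variable {n m : ℕ} (d : Data n m)

/-! The transformed weights. Below, `h` and `k` stand for `Ḣ` and `K̇`. -/

def compQ (H h : ℝ → Matrix (Fin n) (Fin n) ℝ) (t : ℝ) : Matrix (Fin n) (Fin n) ℝ :=
  h t + H t * d.A t + (d.A t)ᵀ * H t + (d.C t)ᵀ * H t * d.C t + d.Q t

def compHatQ (H K k : ℝ → Matrix (Fin n) (Fin n) ℝ) (t : ℝ) : Matrix (Fin n) (Fin n) ℝ :=
  k t + K t * d.hatA t + (d.hatA t)ᵀ * K t + (d.hatC t)ᵀ * H t * d.hatC t + d.hatQ t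

def compS (H : ℝ → Matrix (Fin n) (Fin n) ℝ) (t : ℝ) : Matrix (Fin n) (Fin m) ℝ :=
  H t * d.B t + (d.C t)ᵀ * H t * d.D t + d.S t

def compHatS (H K : ℝ → Matrix (Fin n) (Fin n) ℝ) (t : ℝ) : Matrix (Fin n) (Fin m) ℝ :=
  K t * d.hatB t + (d.hatC t)ᵀ * H t * d.hatD t + d.hatS t

def compR (H : ℝ → Matrix (Fin n) (Fin n) ℝ) (t : ℝ) : Matrix (Fin m) (Fin m) ℝ :=
  (d.D t)ᵀ * H t * d.D t + d.R t

def compHatR (H : ℝ → Matrix (Fin n) (Fin n) ℝ) (t : ℝ) : Matrix (Fin m) (Fin m) ℝ :=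
  (d.hatD t)ᵀ * H t * d.hatD t + d.hatR t

def compG (H : ℝ → Matrix (Fin n) (Fin n) ℝ) : Matrix (Fin n) (Fin n) ℝ :=
  d.G - H d.T

def compHatG (K : ℝ → Matrix (Fin n) (Fin n) ℝ) : Matrix (Fin n) (Fin n) ℝ :=
  d.hatG - K d.T

/-- `(H(·), K(·)) ∈ Λ[0,T] × Λ[0,T]` is a relaxed compensator: the block-diagonal quadruple
`(𝐐^{H,K}, 𝐒^{H,K}, 𝐑^{H,K}, 𝐆^{H,K})` satisfies Condition (PD). -/
def IsRelaxedCompensator (H K : ℝ → Matrix (Fin n) (Fin n) ℝ) : Prop :=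
  ∃ h k : ℝ → Matrix (Fin n) (Fin n) ℝ, MemLambda d.T H h ∧ MemLambda d.T K k ∧
    ConditionPD d.T
      (fun t => fromBlocks (d.compQ H h t) 0 0 (d.compHatQ H K k t))
      (fun t => fromBlocks (d.compS H t) 0 0 (d.compHatS H K t))
      (fun t => fromBlocks (d.compR H t) 0 0 (d.compHatR H t))
      (fromBlocks (d.compG H) 0 0 (d.compHatG K))

/-- `Γ(t,P) = -[DᵀPD + R]⁻¹ [PB + CᵀPD + S]ᵀ`. -/
noncomputable def Gam (t : ℝ) (P : Matrix (Fin n) (Fin n) ℝ) : Matrix (Fin m) (Fin n) ℝ :=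
  -(((d.D t)ᵀ * P * d.D t + d.R t)⁻¹ * (P * d.B t + (d.C t)ᵀ * P * d.D t + d.S t)ᵀ)

/-- `Γ̂(t,P,P̂) = -[D̂ᵀPD̂ + R̂]⁻¹ [P̂B̂ + ĈᵀPD̂ + Ŝ]ᵀ`. -/
noncomputable def hatGam (t : ℝ) (P Ph : Matrix (Fin n) (Fin n) ℝ) :
    Matrix (Fin m) (Fin n) ℝ :=
  -(((d.hatD t)ᵀ * P * d.hatD t + d.hatR t)⁻¹ *
    (Ph * d.hatB t + (d.hatC t)ᵀ * P * d.hatD t + d.hatS t)ᵀ)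

/-- `(P(·), P̂(·))`, of class `C¹([0,T];𝕊ⁿ)`, solves the system of the two Riccati equations,
including the terminal conditions and the constraints `DᵀPD + R ≫ 0`, `D̂ᵀPD̂ + R̂ ≫ 0`. -/
def IsRiccatiSolution (P Ph : ℝ → Matrix (Fin n) (Fin n) ℝ) : Prop :=
  ∃ p ph : ℝ → Matrix (Fin n) (Fin n) ℝ, MemC1 d.T P p ∧ MemC1 d.T Ph ph ∧
    (∀ t ∈ Set.Icc 0 d.T,
      p t + P t * d.A t + (d.A t)ᵀ * P t + (d.C t)ᵀ * P t * d.C t + d.Q t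
        - (d.Gam t (P t))ᵀ * ((d.D t)ᵀ * P t * d.D t + d.R t) * d.Gam t (P t) = 0) ∧
    P d.T = d.G ∧
    UnifPos d.T (fun t => (d.D t)ᵀ * P t * d.D t + d.R t) ∧
    (∀ t ∈ Set.Icc 0 d.T,
      ph t + Ph t * d.hatA t + (d.hatA t)ᵀ * Ph t + (d.hatC t)ᵀ * P t * d.hatC t + d.hatQ t
        - (d.hatGam t (P t) (Ph t))ᵀ * ((d.hatD t)ᵀ * P t * d.hatD t + d.hatR t)
          * d.hatGam t (P t) (Ph t) = 0) ∧
    Ph d.T = d.hatG ∧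
    UnifPos d.T (fun t => (d.hatD t)ᵀ * P t * d.hatD t + d.hatR t)

/-- The system of Riccati equations has a unique pair of solutions: a solution exists, and any other
solution coincides with it on `[0,T]`. -/
def HasUniqueRiccatiSolution : Prop :=
  ∃ P Ph : ℝ → Matrix (Fin n) (Fin n) ℝ, d.IsRiccatiSolution P Ph ∧
    ∀ P₁ Ph₁ : ℝ → Matrix (Fin n) (Fin n) ℝ, d.IsRiccatiSolution P₁ Ph₁ →
      Set.EqOn P₁ P (Set.Icc 0 d.T) ∧ Set.EqOn Ph₁ Ph (Set.Icc 0 d.T)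

end Data

end MFLQ

/-! Both Riccati equations have one common shape. For a feedback `Γ`, completing the square gives
`closed P Γ = ric P + (Γ - gain P)ᵀ (gram P) (Γ - gain P)`, so wherever `gram P` is positive
definite the optimal gain minimises `closed P Γ` in the Loewner order. For fixed `Γ` the map `P ↦
closed P Γ` is affine, with linear part a Lyapunov operator. Everything then rests on one maximum
principle (`posSemidef_of_lyapunov`): a symmetric `Δ` with `Δ̇ + lyap Δ ≤ 0` and `Δ(T) ≥ 0` stays
positive semidefinite. This yields `comparison`, and from it uniqueness, since two solutions
dominate each other.

A relaxed compensator says that `H` is a subsolution of the first equation. Newton iteration, in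
which each term solves the linear equation closed by the gain of the previous one, gives a sequence
decreasing in the Loewner order and bounded below by `H`. That lower bound keeps `gram` positive
definite, hence the gains defined and uniformly bounded. The limit solves the Riccati equation and
satisfies `P ≥ H` (`exists_solution`).

Once `P` is known, the second equation has the same shape without noise terms. Because `P ≥ H`,
replacing `H` by `P` in its weights adds a positive semidefinite block, so `K` is a subsolution and
the same theorem applies.

Conversely, a Riccati solution is itself a relaxed compensator: the transformed block weight factors
through the positive definite control weight, and the terminal defect is zero. -/

namespace MFLQ

open MeasureTheory Matrix Set Filter Topology

/-! ### Continuity of matrix expressions -/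

section Continuity

variable {X : Type*} [TopologicalSpace X] {s : Set X} {l m n : Type*}

@[fun_prop]
theorem continuousOn_matrix_mul [Fintype m] {f : X → Matrix l m ℝ} {g : X → Matrix m n ℝ}
    (hf : ContinuousOn f s) (hg : ContinuousOn g s) : ContinuousOn (fun x => f x * g x) s := by
  rw [continuousOn_iff_continuous_domRestrict] at *
  exact hf.matrix_mul hg

@[fun_prop]
theorem continuousOn_matrix_transpose {f : X → Matrix l m ℝ} (hf : ContinuousOn f s) :
    ContinuousOn (fun x => (f x)ᵀ) s := by
  rw [continuousOn_iff_continuous_domRestrict] at *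
  exact hf.matrix_transpose

theorem continuousOn_matrix_inv [Fintype m] [DecidableEq m] {f : X → Matrix m m ℝ}
    (hf : ContinuousOn f s) (hu : ∀ x ∈ s, IsUnit (f x)) :
    ContinuousOn (fun x => (f x)⁻¹) s := by
  intro x hx
  have h := (Matrix.isUnit_iff_isUnit_det _).1 (hu x hx)
  refine (continuousAt_matrix_inv (f x) ?_).comp_continuousWithinAt (hf x hx)
  rw [Ring.inverse_eq_inv']
  exact continuousAt_inv₀ h.ne_zero

theorem continuousOn_matrix_elem {f : X → Matrix l m ℝ} (hf : ContinuousOn f s) (i : l) (j : m) :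
    ContinuousOn (fun x => f x i j) s := by
  rw [continuousOn_iff_continuous_domRestrict] at *
  exact hf.matrix_elem i j

theorem continuousOn_matrix_of_elem {f : X → Matrix l m ℝ}
    (hf : ∀ i j, ContinuousOn (fun x => f x i j) s) : ContinuousOn f s := by
  simp only [continuousOn_iff_continuous_domRestrict] at *
  exact continuous_matrix hf

end Continuity

/-! ### Global existence for Lipschitz differential equations -/

/-- The coordinatewise truncation of a vector to the sup-norm ball of radius `r`. -/
def truncate {σ : Type*} (r : ℝ) (x : σ → ℝ) : σ → ℝ := fun i => max (-r) (min r (x i))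

section Truncate

variable {σ : Type*} [Fintype σ]

theorem dist_truncate_le (r : ℝ) (x y : σ → ℝ) :
    dist (truncate r x) (truncate r y) ≤ dist x y := by
  refine (dist_pi_le_iff dist_nonneg).2 fun i => le_trans ?_ (dist_le_pi_dist x y i)
  simp only [truncate, Real.dist_eq]
  refine (abs_max_sub_max_le_max _ _ _ _).trans ?_
  refine max_le (by simp) ((abs_min_sub_min_le_max _ _ _ _).trans ?_)
  simp

theorem truncate_eq_self {r : ℝ} {x : σ → ℝ} (h : ‖x‖ ≤ r) : truncate r x = x := by
  funext i
  have := abs_le.1 ((norm_le_pi_norm x i).trans h)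
  simp [truncate, this.1, this.2]

theorem norm_truncate_le {r : ℝ} (hr : 0 ≤ r) (x : σ → ℝ) : ‖truncate r x‖ ≤ r := by
  refine (pi_norm_le_iff_of_nonneg hr).2 fun i => ?_
  rw [Real.norm_eq_abs, abs_le]
  exact ⟨le_max_left _ _, max_le (by linarith) (min_le_left _ _)⟩

theorem norm_truncate_le_norm {r : ℝ} (hr : 0 ≤ r) (x : σ → ℝ) : ‖truncate r x‖ ≤ ‖x‖ := by
  have h0 : truncate r (0 : σ → ℝ) = 0 := truncate_eq_self (by simpa using hr)
  simpa [h0] using dist_truncate_le r x 0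

end Truncate

/-- Truncating the state at the Grönwall radius makes the field bounded, so Picard–Lindelöf covers
the whole interval in one application. The truncated solution obeys the same growth bound, hence
never leaves the ball, and the truncation has no effect on it. -/
theorem exists_forward_solution {σ : Type*} [Fintype σ] {T : ℝ} (hT : 0 ≤ T) {K : NNReal}
    {f : ℝ → (σ → ℝ) → (σ → ℝ)} (hlip : ∀ t ∈ Icc 0 T, LipschitzWith K (f t))
    (hcont : ∀ x, ContinuousOn (fun t => f t x) (Icc 0 T)) (x₀ : σ → ℝ) :
    ∃ x : ℝ → σ → ℝ, x 0 = x₀ ∧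
      ∀ t ∈ Icc 0 T, HasDerivWithinAt x (f t (x t)) (Icc 0 T) t := by
  obtain ⟨b, hb⟩ := isCompact_Icc.exists_bound_of_continuousOn (hcont 0)
  have hb0 : 0 ≤ b := (norm_nonneg _).trans (hb 0 ⟨le_rfl, hT⟩)
  have hgrow : ∀ t ∈ Icc 0 T, ∀ x, ‖f t x‖ ≤ K * ‖x‖ + b := by
    intro t ht x
    have h1 := (hlip t ht).dist_le_mul x 0
    rw [dist_zero_right, dist_eq_norm] at h1
    calc ‖f t x‖ = ‖(f t x - f t 0) + f t 0‖ := by simp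
      _ ≤ _ := (norm_add_le _ _).trans (add_le_add h1 (hb t ht))
  set r := gronwallBound ‖x₀‖ K b T with hr
  have hmono := gronwallBound_mono (norm_nonneg x₀) hb0 K.2
  have hr0 : 0 ≤ r := by
    have := hmono hT
    rw [gronwallBound_x0] at this
    exact (norm_nonneg x₀).trans this
  -- A bound for the truncated field; a ball of radius `L * T` then contains the solution up to time
  -- `T`.
  set L : NNReal := ⟨K * r + b, by positivity⟩
  have hPL : IsPicardLindelof (fun t x => f t (truncate r x)) (⟨0, le_rfl, hT⟩ : Icc (0 : ℝ) T)
      x₀ (L * ⟨T, hT⟩) 0 L K := by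
    refine ⟨fun t ht => ?_, fun x _ => hcont _, fun t ht x _ => ?_, ?_⟩
    · refine (LipschitzWith.of_dist_le_mul fun x y => ?_).lipschitzOnWith
      exact ((hlip t ht).dist_le_mul _ _).trans
        (mul_le_mul_of_nonneg_left (dist_truncate_le r x y) K.2)
    · refine (hgrow t ht _).trans ?_
      change _ ≤ K * r + b
      gcongr
      exact norm_truncate_le hr0 x
    · have h : ((L * ⟨T, hT⟩ : NNReal) : ℝ) = L * T := NNReal.coe_mul _ _
      simp [hT, h]
  obtain ⟨x, hx0, hx⟩ := hPL.exists_eq_forall_mem_Icc_hasDerivWithinAt₀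
  refine ⟨x, hx0, fun t ht => ?_⟩
  have hbound : ∀ t ∈ Icc 0 T, ‖x t‖ ≤ gronwallBound ‖x₀‖ K b (t - 0) := by
    refine norm_le_gronwallBound_of_norm_deriv_right_le
      (f' := fun t => f t (truncate r (x t))) (fun t ht => (hx t ht).continuousWithinAt)
      (fun t ht => ?_) (by simpa using (congrArg norm hx0).le) (fun t ht => ?_)
    · exact (hx t ⟨ht.1, ht.2.le⟩).mono_of_mem_nhdsWithin (Icc_mem_nhdsGE_of_mem ht)
    · refine (hgrow t ⟨ht.1, ht.2.le⟩ _).trans ?_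
      gcongr
      exact norm_truncate_le_norm hr0 _
  have := hx t ht
  rwa [truncate_eq_self] at this
  have h1 := hbound t ht
  rw [sub_zero] at h1
  exact h1.trans (hmono ht.2)

theorem exists_backward_solution {σ : Type*} [Fintype σ] {T : ℝ} (hT : 0 ≤ T) {K : NNReal}
    {f : ℝ → (σ → ℝ) → (σ → ℝ)} (hlip : ∀ t ∈ Icc 0 T, LipschitzWith K (f t))
    (hcont : ∀ x, ContinuousOn (fun t => f t x) (Icc 0 T)) (x₀ : σ → ℝ) :
    ∃ x : ℝ → σ → ℝ, x T = x₀ ∧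
      ∀ t ∈ Icc 0 T, HasDerivWithinAt x (f t (x t)) (Icc 0 T) t := by
  have hmaps : MapsTo (fun t => T - t) (Icc 0 T) (Icc 0 T) :=
    fun t ht => ⟨by linarith [ht.2], by linarith [ht.1]⟩
  obtain ⟨y, hy0, hy⟩ := exists_forward_solution (f := fun t x => -f (T - t) x) hT
    (fun t ht => (hlip _ (hmaps ht)).neg)
    (fun x => ((hcont x).comp (by fun_prop) hmaps).neg) x₀
  refine ⟨fun t => y (T - t), by simpa using hy0, fun t ht => ?_⟩
  have h1 : HasDerivWithinAt (fun t => T - t) (-1) (Icc 0 T) t := by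
    simpa using (hasDerivWithinAt_id t (Icc 0 T)).const_sub T
  have := (hy _ (hmaps ht)).scomp t h1 hmaps
  simpa [Function.comp_def] using this

/-! ### Quadratic forms and `C¹` matrix functions -/

section QuadraticForm

variable {ι : Type*} [Fintype ι]

theorem posSemidef_iff_isSymm {M : Matrix ι ι ℝ} :
    M.PosSemidef ↔ M.IsSymm ∧ ∀ v, 0 ≤ v ⬝ᵥ (M *ᵥ v) := by
  rw [posSemidef_iff_dotProduct_mulVec]
  simp only [star_trivial, IsHermitian, conjTranspose_eq_transpose_of_trivial, IsSymm]

theorem _root_.Matrix.PosSemidef.isSymm {M : Matrix ι ι ℝ} (h : M.PosSemidef) : M.IsSymm :=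
  (posSemidef_iff_isSymm.1 h).1

theorem _root_.Matrix.PosSemidef.quad_nonneg {M : Matrix ι ι ℝ} (h : M.PosSemidef) (v : ι → ℝ) :
    0 ≤ v ⬝ᵥ (M *ᵥ v) :=
  (posSemidef_iff_isSymm.1 h).2 v

theorem _root_.Matrix.PosSemidef.transpose_mul_mul {κ : Type*} [Fintype κ] {M : Matrix ι ι ℝ}
    (h : M.PosSemidef) (B : Matrix ι κ ℝ) : (Bᵀ * M * B).PosSemidef := by
  simpa using h.conjTranspose_mul_mul_same B

theorem continuousOn_quad {X : Type*} [TopologicalSpace X] {s : Set X} {M : X → Matrix ι ι ℝ}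
    {v : X → ι → ℝ} (hM : ContinuousOn M s) (hv : ContinuousOn v s) :
    ContinuousOn (fun x => v x ⬝ᵥ (M x *ᵥ v x)) s := by
  rw [continuousOn_iff_continuous_domRestrict] at *
  exact hv.dotProduct (hM.matrix_mulVec hv)

theorem dotProduct_self_pos {v : ι → ℝ} (hv : v ≠ 0) : 0 < v ⬝ᵥ v :=
  lt_of_le_of_ne (Finset.sum_nonneg fun i _ => mul_self_nonneg (v i))
    fun h => hv (dotProduct_self_eq_zero.1 h.symm)

end QuadraticForm

theorem MemC1.continuousOn {n : ℕ} {T : ℝ} {F f : ℝ → Matrix (Fin n) (Fin n) ℝ}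
    (h : MemC1 T F f) : ContinuousOn F (Icc 0 T) :=
  continuousOn_matrix_of_elem fun i j t ht => (h.2.2 t ht i j).continuousWithinAt

theorem MemC1.hasDerivWithinAt_quad {n : ℕ} {T : ℝ} {F f : ℝ → Matrix (Fin n) (Fin n) ℝ}
    (h : MemC1 T F f) {t : ℝ} (ht : t ∈ Icc 0 T) (v : Fin n → ℝ) :
    HasDerivWithinAt (fun s => v ⬝ᵥ (F s *ᵥ v)) (v ⬝ᵥ (f t *ᵥ v)) (Icc 0 T) t := by
  simp only [dotProduct, mulVec]
  exact HasDerivWithinAt.fun_sum fun i _ => HasDerivWithinAt.const_mul _ <|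
    HasDerivWithinAt.fun_sum fun j _ => (h.2.2 t ht i j).mul_const _

theorem MemC1.sub {n : ℕ} {T : ℝ} {F f E e : ℝ → Matrix (Fin n) (Fin n) ℝ}
    (hF : MemC1 T F f) (hE : MemC1 T E e) :
    MemC1 T (fun t => F t - E t) (fun t => f t - e t) :=
  ⟨fun t ht => (hF.1 t ht).sub (hE.1 t ht), hF.2.1.sub hE.2.1,
    fun t ht i j => (hF.2.2 t ht i j).fun_sub (hE.2.2 t ht i j)⟩

/-! ### Lyapunov inequalities and equations -/

/-- The Lyapunov operator `P ↦ PF + FᵀP + CᵀPC`. -/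
def lyap {ι : Type*} [Fintype ι] (F C P : Matrix ι ι ℝ) : Matrix ι ι ℝ :=
  P * F + Fᵀ * P + Cᵀ * P * C

section Lyap

variable {ι : Type*} [Fintype ι]

theorem lyap_add (F C P P' : Matrix ι ι ℝ) : lyap F C (P + P') = lyap F C P + lyap F C P' := by
  simp only [lyap, mul_add, add_mul]; abel

theorem lyap_smul (F C P : Matrix ι ι ℝ) (c : ℝ) : lyap F C (c • P) = c • lyap F C P := by
  simp [lyap]

theorem lyap_transpose (F C P : Matrix ι ι ℝ) : (lyap F C P)ᵀ = lyap F C Pᵀ := by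
  simp only [lyap, transpose_add, transpose_mul, transpose_transpose, mul_assoc]; abel

theorem quad_lyap (F C P : Matrix ι ι ℝ) (v : ι → ℝ) :
    v ⬝ᵥ (lyap F C P *ᵥ v) =
      (Pᵀ *ᵥ v) ⬝ᵥ (F *ᵥ v) + (F *ᵥ v) ⬝ᵥ (P *ᵥ v) + (C *ᵥ v) ⬝ᵥ (P *ᵥ (C *ᵥ v)) := by
  have h : ∀ (X : Matrix ι ι ℝ) (w : ι → ℝ), v ⬝ᵥ (Xᵀ *ᵥ w) = (X *ᵥ v) ⬝ᵥ w := fun X w => by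
    rw [dotProduct_mulVec, vecMul_transpose]
  simp only [lyap, add_mulVec, dotProduct_add, ← mulVec_mulVec, h]
  rw [dotProduct_mulVec v P, ← mulVec_transpose]

end Lyap

theorem continuousOn_lyap {X ι : Type*} [Fintype ι] [TopologicalSpace X] {s : Set X}
    {F C P : X → Matrix ι ι ℝ}
    (hF : ContinuousOn F s) (hC : ContinuousOn C s) (hP : ContinuousOn P s) :
    ContinuousOn (fun x => lyap (F x) (C x) (P x)) s := by
  unfold lyap; fun_prop

/-- Let `e(t)` be the exponential weight and suppose `Δ + e I` fails to be positive definite. At the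
last such time it is positive semidefinite with a kernel vector `v₀`, so in its Lyapunov form at
`v₀` only the nonnegative `C`-term survives. With the inequality for `Δ` and the bound `b`, the time
derivative of the form at `v₀` is at most `-e (v₀ ⬝ᵥ v₀) < 0`. But the form vanishes there and is
positive afterwards. The rate `b + 1` in the exponent provides the strict sign. -/
theorem quad_pos_of_lyapunov {n : ℕ} {T : ℝ} {F C Δ δ : ℝ → Matrix (Fin n) (Fin n) ℝ}
    (hΔ : MemC1 T Δ δ)
    (hineq : ∀ t ∈ Icc 0 T, (-(δ t + lyap (F t) (C t) (Δ t))).PosSemidef)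
    (hterm : (Δ T).PosSemidef) {b ε : ℝ} (hε : 0 < ε)
    (hb : ∀ t ∈ Icc 0 T, ∀ v : Fin n → ℝ, ‖v‖ = 1 →
      v ⬝ᵥ (lyap (F t) (C t) 1 *ᵥ v) ≤ b * (v ⬝ᵥ v)) :
    ∀ t ∈ Icc 0 T, ∀ v : Fin n → ℝ, v ≠ 0 →
      0 < v ⬝ᵥ (Δ t *ᵥ v) + ε * Real.exp ((b + 1) * (T - t)) * (v ⬝ᵥ v) := by
  set q : ℝ → (Fin n → ℝ) → ℝ :=
    fun t v => v ⬝ᵥ (Δ t *ᵥ v) + ε * Real.exp ((b + 1) * (T - t)) * (v ⬝ᵥ v) with hq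
  have hqsmul : ∀ t c v, q t (c • v) = c ^ 2 * q t v := by
    intro t c v
    simp only [hq, mulVec_smul, dotProduct_smul, smul_dotProduct, smul_eq_mul]
    ring
  have hqcont : ContinuousOn (fun p : ℝ × (Fin n → ℝ) => q p.1 p.2)
      (Icc 0 T ×ˢ Metric.sphere 0 1) := by
    refine (continuousOn_quad (hΔ.continuousOn.comp continuousOn_fst fun p hp => hp.1)
      continuousOn_snd).add (Continuous.continuousOn ?_)
    exact Continuous.mul (by fun_prop) (continuous_snd.dotProduct continuous_snd)
  have hqderiv : ∀ t ∈ Icc 0 T, ∀ v, HasDerivWithinAt (fun s => q s v)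
      (v ⬝ᵥ (δ t *ᵥ v) - ε * Real.exp ((b + 1) * (T - t)) * (b + 1) * (v ⬝ᵥ v)) (Icc 0 T) t := by
    intro t ht v
    have h1 : HasDerivAt (fun s => ε * Real.exp ((b + 1) * (T - s)) * (v ⬝ᵥ v))
        (ε * (Real.exp ((b + 1) * (T - t)) * ((b + 1) * (-1))) * (v ⬝ᵥ v)) t :=
      (((((hasDerivAt_id t).const_sub T).const_mul (b + 1)).exp).const_mul ε).mul_const _
    exact ((hΔ.hasDerivWithinAt_quad ht v).fun_add h1.hasDerivWithinAt).congr_deriv (by ring)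
  set Z : Set (ℝ × (Fin n → ℝ)) :=
    (Icc 0 T ×ˢ Metric.sphere 0 1) ∩ (fun p => q p.1 p.2) ⁻¹' Iic 0 with hZ
  have hcpt : IsCompact (Icc 0 T ×ˢ Metric.sphere (0 : Fin n → ℝ) 1) :=
    isCompact_Icc.prod (isCompact_sphere _ _)
  have hZc : IsCompact Z := hcpt.of_isClosed_subset
    (hqcont.preimage_isClosed_of_isClosed hcpt.isClosed isClosed_Iic) inter_subset_left
  have hout : ∀ t ∈ Icc 0 T, (∀ v, (t, v) ∉ Z) → ∀ v ≠ 0, 0 < q t v := by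
    intro t ht h v hv
    have hv' : ‖v‖ ≠ 0 := norm_ne_zero_iff.2 hv
    have h1 := h (‖v‖⁻¹ • v)
    have h2 : ‖‖v‖⁻¹ • v‖ = 1 := by simp [norm_smul, hv']
    have h3 : 0 < q t (‖v‖⁻¹ • v) := by
      by_contra hneg
      exact h1 ⟨⟨ht, by simpa using h2⟩, not_lt.1 hneg⟩
    rw [hqsmul] at h3
    exact pos_of_mul_pos_right h3 (sq_nonneg _)
  suffices hempty : Z = ∅ from fun t ht v hv => hout t ht (by simp [hempty]) v hv
  by_contra hne
  -- The last time at which the form is nonpositive at some unit vector, attained by compactness.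
  obtain ⟨⟨t₀, v₀⟩, hmem, hmax⟩ := hZc.exists_isMaxOn (nonempty_iff_ne_empty.2 hne)
    continuousOn_fst
  obtain ⟨⟨ht₀, hv₀⟩, hle⟩ := hmem
  replace hv₀ : ‖v₀‖ = 1 := by simpa using hv₀
  replace hle : q t₀ v₀ ≤ 0 := hle
  have hv₀0 : v₀ ≠ 0 := by rintro rfl; simp at hv₀
  have hafter : ∀ t ∈ Ioc t₀ T, ∀ v ≠ 0, 0 < q t v := by
    intro t ht
    refine hout t ⟨ht₀.1.trans ht.1.le, ht.2⟩ fun v hv => ?_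
    exact absurd (hmax hv) (not_le.2 ht.1)
  have ht₀T : t₀ < T := by
    refine lt_of_le_of_ne ht₀.2 fun h => ?_
    have h1 := hterm.quad_nonneg v₀
    have h2 := dotProduct_self_pos hv₀0
    have h3 : 0 < q t₀ v₀ := by
      simp only [hq, h]
      positivity
    exact absurd hle (not_le.2 h3)
  have hsub : Ioc t₀ T ⊆ Icc 0 T := fun t ht => ⟨ht₀.1.trans ht.1.le, ht.2⟩
  have hnhds : 𝓝[Ioc t₀ T] t₀ = 𝓝[>] t₀ := nhdsWithin_Ioc_eq_nhdsGT ht₀T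
  have hnn : ∀ v, 0 ≤ q t₀ v := by
    intro v
    rcases eq_or_ne v 0 with rfl | hv
    · simp [hq]
    have h1 : Tendsto (fun s => q s v) (𝓝[Ioc t₀ T] t₀) (𝓝 (q t₀ v)) :=
      ((hqderiv t₀ ht₀ v).continuousWithinAt).mono hsub
    have : (𝓝[Ioc t₀ T] t₀).NeBot := by rw [hnhds]; infer_instance
    exact ge_of_tendsto h1 (eventually_mem_nhdsWithin.mono fun t ht => (hafter t ht v hv).le)
  have hzero : q t₀ v₀ = 0 := le_antisymm hle (hnn v₀)
  set e := ε * Real.exp ((b + 1) * (T - t₀)) with he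
  have he0 : 0 < e := by positivity
  have hquad : ∀ v, v ⬝ᵥ ((Δ t₀ + e • (1 : Matrix _ _ ℝ)) *ᵥ v) = q t₀ v := by
    intro v
    simp [hq, add_mulVec, smul_mulVec, dotProduct_add, he]
  have hpsd : (Δ t₀ + e • (1 : Matrix _ _ ℝ)).PosSemidef :=
    posSemidef_iff_isSymm.2 ⟨(hΔ.1 t₀ ht₀).add (isSymm_one.smul e), fun v => by
      rw [hquad]; exact hnn v⟩
  have hker : (Δ t₀ + e • (1 : Matrix _ _ ℝ)) *ᵥ v₀ = 0 :=
    (hpsd.dotProduct_mulVec_zero_iff v₀).1 (by rw [star_trivial, hquad, hzero])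
  have hlyap : 0 ≤ v₀ ⬝ᵥ (lyap (F t₀) (C t₀) (Δ t₀ + e • (1 : Matrix _ _ ℝ)) *ᵥ v₀) := by
    rw [quad_lyap, hpsd.isSymm.eq, hker]
    simpa using hpsd.quad_nonneg (C t₀ *ᵥ v₀)
  rw [lyap_add, lyap_smul, add_mulVec, smul_mulVec, dotProduct_add, dotProduct_smul,
    smul_eq_mul] at hlyap
  have h1 := (hineq t₀ ht₀).quad_nonneg v₀
  rw [neg_mulVec, dotProduct_neg, add_mulVec, dotProduct_add] at h1
  have h2 := mul_le_mul_of_nonneg_left (hb t₀ ht₀ v₀ hv₀) he0.le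
  have h3 : 0 < e * (v₀ ⬝ᵥ v₀) := mul_pos he0 (dotProduct_self_pos hv₀0)
  have hslope : Tendsto (slope (fun s => q s v₀) t₀) (𝓝[Ioc t₀ T] t₀)
      (𝓝 (v₀ ⬝ᵥ (δ t₀ *ᵥ v₀) - e * (b + 1) * (v₀ ⬝ᵥ v₀))) :=
    (hasDerivWithinAt_iff_tendsto_slope' (by simp)).1 ((hqderiv t₀ ht₀ v₀).mono hsub)
  have : (𝓝[Ioc t₀ T] t₀).NeBot := by rw [hnhds]; infer_instance
  have h4 := ge_of_tendsto hslope (b := 0) <| eventually_mem_nhdsWithin.mono fun t ht => by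
    rw [slope_def_field, hzero, sub_zero]
    exact div_nonneg (hafter t ht v₀ hv₀0).le (sub_nonneg.2 ht.1.le)
  nlinarith

/-- The strict version holds for every `ε > 0` with the same `b`; let `ε` tend to zero. -/
theorem posSemidef_of_lyapunov {n : ℕ} {T : ℝ} {F C Δ δ : ℝ → Matrix (Fin n) (Fin n) ℝ}
    (hF : ContinuousOn F (Icc 0 T)) (hC : ContinuousOn C (Icc 0 T)) (hΔ : MemC1 T Δ δ)
    (hineq : ∀ t ∈ Icc 0 T, (-(δ t + lyap (F t) (C t) (Δ t))).PosSemidef)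
    (hterm : (Δ T).PosSemidef) {t : ℝ} (ht : t ∈ Icc 0 T) : (Δ t).PosSemidef := by
  -- The sphere is that of the sup norm, while the bound is relative to `v ⬝ᵥ v`; hence the
  -- quotient.
  have hcont : ContinuousOn (fun p : ℝ × (Fin n → ℝ) =>
      (p.2 ⬝ᵥ (lyap (F p.1) (C p.1) 1 *ᵥ p.2)) / (p.2 ⬝ᵥ p.2))
      (Icc 0 T ×ˢ Metric.sphere 0 1) := by
    refine (continuousOn_quad ?_ continuousOn_snd).div
      (continuous_snd.dotProduct continuous_snd).continuousOn fun p hp => ?_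
    · exact (continuousOn_lyap hF hC continuousOn_const).comp continuousOn_fst fun p hp => hp.1
    · refine (dotProduct_self_pos fun h => ?_).ne'
      have := hp.2
      simp [h] at this
  obtain ⟨b, hb⟩ := (isCompact_Icc.prod (isCompact_sphere _ _)).exists_bound_of_continuousOn hcont
  refine posSemidef_iff_isSymm.2 ⟨hΔ.1 t ht, fun v => ?_⟩
  rcases eq_or_ne v 0 with rfl | hv
  · simp
  have hpos : ∀ ε > 0, 0 < v ⬝ᵥ (Δ t *ᵥ v) + ε * Real.exp ((b + 1) * (T - t)) * (v ⬝ᵥ v) := by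
    intro ε hε
    refine quad_pos_of_lyapunov hΔ hineq hterm hε (fun s hs w hw => ?_) t ht v hv
    have h0 : 0 < w ⬝ᵥ w := dotProduct_self_pos fun h => by simp [h] at hw
    rw [← div_le_iff₀ h0]
    exact (le_abs_self _).trans (hb (s, w) ⟨hs, by simpa using hw⟩)
  refine ge_of_tendsto (b := 0) (x := 𝓝[>] (0 : ℝ))
    (f := fun ε => v ⬝ᵥ (Δ t *ᵥ v) + ε * Real.exp ((b + 1) * (T - t)) * (v ⬝ᵥ v)) ?_
    (eventually_mem_nhdsWithin.mono fun ε hε => (hpos ε hε).le)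
  have : Continuous fun ε : ℝ =>
      v ⬝ᵥ (Δ t *ᵥ v) + ε * Real.exp ((b + 1) * (T - t)) * (v ⬝ᵥ v) := by fun_prop
  simpa using (this.tendsto 0).mono_left nhdsWithin_le_nhds

theorem exists_linear_solution {σ : Type*} [Fintype σ] {T : ℝ} (hT : 0 ≤ T)
    {M : ℝ → (σ → ℝ) →L[ℝ] (σ → ℝ)} {g : ℝ → σ → ℝ}
    (hM : ∀ x, ContinuousOn (fun t => M t x) (Icc 0 T)) (hg : ContinuousOn g (Icc 0 T))
    (x₀ : σ → ℝ) :
    ∃ x : ℝ → σ → ℝ, x T = x₀ ∧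
      ∀ t ∈ Icc 0 T, HasDerivWithinAt x (M t (x t) + g t) (Icc 0 T) t := by
  obtain ⟨K, hK⟩ := isCompact_Icc.exists_bound_of_continuousOn (continuousOn_clm_apply.2 hM)
  have hK0 : 0 ≤ K := (norm_nonneg _).trans (hK 0 ⟨le_rfl, hT⟩)
  refine exists_backward_solution (K := ⟨K, hK0⟩) (f := fun t x => M t x + g t) hT
    (fun t ht => LipschitzWith.of_dist_le_mul fun x y => ?_) (fun x => (hM x).add hg) x₀
  rw [dist_add_right, dist_eq_norm, dist_eq_norm, ← map_sub]
  exact (M t).le_of_opNorm_le (hK t ht) _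

/-- The linear equation is first solved for arbitrary matrices. Since the Lyapunov operator commutes
with transposition and `N`, `G` are symmetric, the symmetric part of that solution is again a
solution. -/
theorem exists_lyapunov_solution {n : ℕ} {T : ℝ} (hT : 0 ≤ T)
    {F C N : ℝ → Matrix (Fin n) (Fin n) ℝ} {G : Matrix (Fin n) (Fin n) ℝ}
    (hF : ContinuousOn F (Icc 0 T)) (hC : ContinuousOn C (Icc 0 T))
    (hN : ContinuousOn N (Icc 0 T)) (hNs : ∀ t ∈ Icc 0 T, (N t).IsSymm) (hG : G.IsSymm) :
    ∃ P : ℝ → Matrix (Fin n) (Fin n) ℝ, P T = G ∧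
      MemC1 T P (fun t => -(lyap (F t) (C t) (P t) + N t)) := by
  let toMat : (Fin n × Fin n → ℝ) → Matrix (Fin n) (Fin n) ℝ := fun x => of fun i j => x (i, j)
  let M : ℝ → (Fin n × Fin n → ℝ) →ₗ[ℝ] (Fin n × Fin n → ℝ) := fun t =>
    { toFun := fun x ij => -lyap (F t) (C t) (toMat x) ij.1 ij.2
      map_add' := fun x y => by
        have : toMat (x + y) = toMat x + toMat y := rfl
        funext ij
        simp only [this, lyap_add, Pi.add_apply, Matrix.add_apply, neg_add]
      map_smul' := fun c x => by
        have : toMat (c • x) = c • toMat x := rfl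
        funext ij
        simp [this, lyap_smul] }
  obtain ⟨x, hxT, hx⟩ := exists_linear_solution (M := fun t => (M t).toContinuousLinearMap)
    (g := fun t ij => -N t ij.1 ij.2) hT
    (fun x => continuousOn_pi.2 fun ij =>
      (continuousOn_matrix_elem (continuousOn_lyap hF hC continuousOn_const) ij.1 ij.2).neg)
    (continuousOn_pi.2 fun ij => (continuousOn_matrix_elem hN ij.1 ij.2).neg)
    (fun ij => G ij.1 ij.2)
  have hd : ∀ t ∈ Icc 0 T, ∀ i j, HasDerivWithinAt (fun s => x s (i, j))
      (-(lyap (F t) (C t) (toMat (x t)) + N t) i j) (Icc 0 T) t := by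
    intro t ht i j
    exact ((hasDerivWithinAt_pi.1 (hx t ht)) (i, j)).congr_deriv (by simp [M]; ring)
  have hlyap : ∀ t ∈ Icc 0 T, ∀ Y, (lyap (F t) (C t) ((1 / 2 : ℝ) • (Y + Yᵀ)) + N t) =
      (1 / 2 : ℝ) • ((lyap (F t) (C t) Y + N t) + (lyap (F t) (C t) Y + N t)ᵀ) := by
    intro t ht Y
    rw [transpose_add, lyap_transpose, (hNs t ht).eq, lyap_smul, lyap_add]
    module
  have hder : ∀ t ∈ Icc 0 T, ∀ i j,
      HasDerivWithinAt (fun s => ((1 / 2 : ℝ) • (toMat (x s) + (toMat (x s))ᵀ)) i j)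
      ((-(lyap (F t) (C t) ((1 / 2 : ℝ) • (toMat (x t) + (toMat (x t))ᵀ)) + N t)) i j)
      (Icc 0 T) t := by
    intro t ht i j
    rw [hlyap t ht]
    refine (((hd t ht i j).fun_add (hd t ht j i)).const_mul (1 / 2 : ℝ)).congr_deriv ?_
    simp
    ring
  have hcont : ContinuousOn (fun s => (1 / 2 : ℝ) • (toMat (x s) + (toMat (x s))ᵀ)) (Icc 0 T) :=
    continuousOn_matrix_of_elem fun i j t ht => (hder t ht i j).continuousWithinAt
  refine ⟨fun s => (1 / 2 : ℝ) • (toMat (x s) + (toMat (x s))ᵀ), ?_, fun t _ => ?_,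
    ((continuousOn_lyap hF hC hcont).add hN).neg, hder⟩
  · have : toMat (x T) = G := by rw [hxT]; rfl
    simp only [this, hG.eq]
    module
  · simp [IsSymm, add_comm]

/-! ### The integral and the differential description of `C¹` functions -/

theorem MemLambda.memC1 {n : ℕ} {T : ℝ} {F f : ℝ → Matrix (Fin n) (Fin n) ℝ}
    (h : MemLambda T F f) : MemC1 T F f := by
  refine ⟨h.2.1, h.1.1, fun t ht i j => ?_⟩
  have hT : 0 ≤ T := ht.1.trans ht.2
  have hc := continuousOn_matrix_elem h.1.1 i j
  -- The density is controlled only on `[0,T]`; a constant extension beyond the endpoints makes it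
  -- continuous on the line, so the fundamental theorem of calculus also applies at the endpoints.
  have hg : Continuous (IccExtend hT ((Icc 0 T).domRestrict fun s => f s i j)) :=
    (continuousOn_iff_continuous_domRestrict.1 hc).Icc_extend'
  set g := IccExtend hT ((Icc 0 T).domRestrict fun s => f s i j) with hgdef
  have hgf : ∀ s ∈ Icc 0 T, g s = f s i j := fun s hs => by
    rw [hgdef, IccExtend_of_mem hT _ hs]; rfl
  have hd : HasDerivAt (fun s => F 0 i j + ∫ r in (0 : ℝ)..s, g r) (g t) t :=
    ((hg.integral_hasStrictDerivAt 0 t).hasDerivAt).const_add _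
  rw [← hgf t ht]
  refine hd.hasDerivWithinAt.congr_of_mem (fun s hs => ?_) ht
  rw [h.2.2 s hs, Matrix.add_apply, of_apply]
  congr 1
  refine intervalIntegral.integral_congr fun r hr => (hgf r ?_).symm
  rw [uIcc_of_le hs.1] at hr
  exact ⟨hr.1, hr.2.trans hs.2⟩

theorem MemC1.memLambda {n : ℕ} {T : ℝ} (hT : 0 < T) {F f : ℝ → Matrix (Fin n) (Fin n) ℝ}
    (h : MemC1 T F f) : MemLambda T F f := by
  refine ⟨⟨h.2.1, fun t ht => ?_⟩, h.1, fun t ht => ?_⟩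
  · ext i j
    have h1 := (h.2.2 t ht j i).congr_of_mem (f₁ := fun s => F s i j)
      (fun s hs => (h.1 s hs).apply j i) ht
    exact (uniqueDiffOn_Icc hT t ht).eq_deriv _ h1 (h.2.2 t ht i j)
  · ext i j
    have hsub : Icc 0 t ⊆ Icc 0 T := Icc_subset_Icc_right ht.2
    have hc := (continuousOn_matrix_elem h.2.1 i j).mono hsub
    have := intervalIntegral.integral_eq_sub_of_hasDeriv_right_of_le ht.1
      ((continuousOn_matrix_elem h.continuousOn i j).mono hsub)
      (fun s hs => (h.2.2 s (hsub (Ioo_subset_Icc_self hs)) i j).mono_of_mem_nhdsWithin <|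
        Icc_mem_nhdsGT_of_mem ⟨hs.1.le, hs.2.trans_le ht.2⟩)
      (hc.intervalIntegrable_of_Icc ht.1)
    simp [this]

/-! ### Bounds and monotone convergence in the Loewner order -/

section PosSemidef

variable {ι : Type*} [Fintype ι]

theorem isClosed_posSemidef : IsClosed {M : Matrix ι ι ℝ | M.PosSemidef} := by
  simp only [posSemidef_iff_isSymm, ofPred_and, ofPred_forall]
  refine (isClosed_eq continuous_id.matrix_transpose continuous_id).inter
    (isClosed_iInter fun v => isClosed_le continuous_const ?_)
  exact continuous_const.dotProduct (continuous_id.matrix_mulVec continuous_const)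

/-- Testing on `eᵢ ± eⱼ` gives `2|Mᵢⱼ| ≤ Mᵢᵢ + Mⱼⱼ`, and each diagonal entry is at most the trace.
-/
theorem abs_apply_le_trace [DecidableEq ι] {M : Matrix ι ι ℝ} (h : M.PosSemidef) (i j : ι) :
    |M i j| ≤ M.trace := by
  have h1 := h.quad_nonneg (Pi.single i 1 + Pi.single j 1)
  have h2 := h.quad_nonneg (Pi.single i 1 - Pi.single j 1)
  have hd : ∀ k, M k k ≤ M.trace := fun k =>
    Finset.single_le_sum (f := fun k => M k k) (fun k _ => h.diag_nonneg) (Finset.mem_univ k)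
  have hs := h.isSymm.apply i j
  simp [mulVec_add, mulVec_sub] at h1 h2
  rw [abs_le]
  constructor <;> linarith [hd i, hd j]

/-- Each quadratic form is a decreasing real sequence bounded below; polarization recovers the
entries of the symmetric matrices from these forms. -/
theorem exists_tendsto_of_antitone [DecidableEq ι] {X : ℕ → Matrix ι ι ℝ} {H : Matrix ι ι ℝ}
    (hs : ∀ k, (X k).IsSymm) (hX : ∀ k, (X k - X (k + 1)).PosSemidef)
    (hH : ∀ k, (X k - H).PosSemidef) : ∃ L, Tendsto X atTop (𝓝 L) := by
  have hq : ∀ v : ι → ℝ, ∃ l, Tendsto (fun k => v ⬝ᵥ (X k *ᵥ v)) atTop (𝓝 l) := fun v => by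
    refine ⟨_, tendsto_atTop_ciInf (antitone_nat_of_succ_le fun k => ?_)
      ⟨v ⬝ᵥ (H *ᵥ v), ?_⟩⟩
    · have := (hX k).quad_nonneg v
      rw [sub_mulVec, dotProduct_sub] at this
      linarith
    · rintro _ ⟨k, rfl⟩
      have := (hH k).quad_nonneg v
      rw [sub_mulVec, dotProduct_sub] at this
      linarith
  choose l hl using hq
  have hpol : ∀ k i j, X k i j = 1 / 2 *
      ((Pi.single i 1 + Pi.single j 1) ⬝ᵥ (X k *ᵥ (Pi.single i 1 + Pi.single j 1))
        - Pi.single i 1 ⬝ᵥ (X k *ᵥ Pi.single i 1) - Pi.single j 1 ⬝ᵥ (X k *ᵥ Pi.single j 1)) := by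
    intro k i j
    have := (hs k).apply i j
    simp [mulVec_add]
    linarith
  refine ⟨of fun i j => 1 / 2 * (l (Pi.single i 1 + Pi.single j 1) - l (Pi.single i 1)
    - l (Pi.single j 1)), tendsto_pi_nhds.2 fun i => tendsto_pi_nhds.2 fun j => ?_⟩
  simp only [hpol]
  exact (((hl _).sub (hl _)).sub (hl _)).const_mul _

end PosSemidef

/-! ### A single Riccati equation: completing the square, comparison, uniqueness -/

/-- The coefficients of a matrix Riccati equation
`Ṗ + PA + AᵀP + CᵀPC + Q - (PB + CᵀPD + S)(DᵀPD + R)⁻¹(PB + CᵀPD + S)ᵀ = 0` on `[0,T]`. -/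
structure RiccatiData (n m : ℕ) (T : ℝ) where
  A : ℝ → Matrix (Fin n) (Fin n) ℝ
  B : ℝ → Matrix (Fin n) (Fin m) ℝ
  C : ℝ → Matrix (Fin n) (Fin n) ℝ
  D : ℝ → Matrix (Fin n) (Fin m) ℝ
  Q : ℝ → Matrix (Fin n) (Fin n) ℝ
  S : ℝ → Matrix (Fin n) (Fin m) ℝ
  R : ℝ → Matrix (Fin m) (Fin m) ℝ
  contA : ContinuousOn A (Icc 0 T)
  contB : ContinuousOn B (Icc 0 T)
  contC : ContinuousOn C (Icc 0 T)
  contD : ContinuousOn D (Icc 0 T)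
  contQ : ContinuousOn Q (Icc 0 T)
  contS : ContinuousOn S (Icc 0 T)
  contR : ContinuousOn R (Icc 0 T)
  symmQ : ∀ t ∈ Icc 0 T, (Q t).IsSymm
  symmR : ∀ t ∈ Icc 0 T, (R t).IsSymm

namespace RiccatiData

variable {n m : ℕ} {T : ℝ} (e : RiccatiData n m T)

/-- `PA + AᵀP + CᵀPC + Q`. -/
def base (t : ℝ) (P : Matrix (Fin n) (Fin n) ℝ) : Matrix (Fin n) (Fin n) ℝ :=
  P * e.A t + (e.A t)ᵀ * P + (e.C t)ᵀ * P * e.C t + e.Q t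

/-- `PB + CᵀPD + S`. -/
def cross (t : ℝ) (P : Matrix (Fin n) (Fin n) ℝ) : Matrix (Fin n) (Fin m) ℝ :=
  P * e.B t + (e.C t)ᵀ * P * e.D t + e.S t

/-- `DᵀPD + R`. -/
def gram (t : ℝ) (P : Matrix (Fin n) (Fin n) ℝ) : Matrix (Fin m) (Fin m) ℝ :=
  (e.D t)ᵀ * P * e.D t + e.R t

/-- The optimal feedback gain `-(DᵀPD + R)⁻¹(PB + CᵀPD + S)ᵀ`. -/
noncomputable def gain (t : ℝ) (P : Matrix (Fin n) (Fin n) ℝ) : Matrix (Fin m) (Fin n) ℝ :=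
  -((e.gram t P)⁻¹ * (e.cross t P)ᵀ)

/-- The Riccati operator. -/
noncomputable def ric (t : ℝ) (P : Matrix (Fin n) (Fin n) ℝ) : Matrix (Fin n) (Fin n) ℝ :=
  e.base t P - (e.gain t P)ᵀ * e.gram t P * e.gain t P

/-- The affine Lyapunov operator of the system closed by the feedback `Γ`. -/
def closed (t : ℝ) (P : Matrix (Fin n) (Fin n) ℝ) (Γ : Matrix (Fin m) (Fin n) ℝ) :
    Matrix (Fin n) (Fin n) ℝ :=
  e.base t P + e.cross t P * Γ + Γᵀ * (e.cross t P)ᵀ + Γᵀ * e.gram t P * Γ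

section Algebra

variable {t : ℝ} {P P' : Matrix (Fin n) (Fin n) ℝ}

theorem gram_isSymm (ht : t ∈ Icc 0 T) (hP : P.IsSymm) : (e.gram t P).IsSymm := by
  simp only [IsSymm, gram, transpose_add, transpose_mul, transpose_transpose, hP.eq,
    (e.symmR t ht).eq, Matrix.mul_assoc]

theorem base_isSymm (ht : t ∈ Icc 0 T) (hP : P.IsSymm) : (e.base t P).IsSymm := by
  simp only [IsSymm, base, transpose_add, transpose_mul, transpose_transpose, hP.eq,
    (e.symmQ t ht).eq, Matrix.mul_assoc]
  abel

theorem closed_isSymm (ht : t ∈ Icc 0 T) (hP : P.IsSymm) (Γ : Matrix (Fin m) (Fin n) ℝ) :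
    (e.closed t P Γ).IsSymm := by
  simp only [IsSymm, closed, transpose_add, transpose_mul, transpose_transpose,
    (e.base_isSymm ht hP).eq, (e.gram_isSymm ht hP).eq, Matrix.mul_assoc]
  abel

/-- Completion of the square, resting on `gram * gain = -crossᵀ`. -/
theorem closed_eq_ric_add (hu : IsUnit (e.gram t P)) (hs : (e.gram t P).IsSymm)
    (Γ : Matrix (Fin m) (Fin n) ℝ) :
    e.closed t P Γ = e.ric t P + (Γ - e.gain t P)ᵀ * e.gram t P * (Γ - e.gain t P) := by
  have h1 : e.gram t P * e.gain t P = -(e.cross t P)ᵀ := by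
    rw [gain, Matrix.mul_neg, mul_nonsing_inv_cancel_left _ _ ((isUnit_iff_isUnit_det _).1 hu)]
  have h2 : (e.gain t P)ᵀ * e.gram t P = -e.cross t P := by
    rw [← congrArg (fun M => (e.gain t P)ᵀ * M) hs.eq, ← transpose_mul, h1, transpose_neg, transpose_transpose]
  rw [closed, ric, transpose_sub]
  simp only [Matrix.sub_mul, Matrix.mul_sub]
  rw [h2, Matrix.mul_assoc Γᵀ _ (e.gain t P), h1]
  simp only [Matrix.neg_mul, Matrix.mul_neg]
  abel

/-- With the feedback frozen, the dependence on `P` is affine: the inverse in `ric` is gone and a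
Lyapunov operator with closed-loop coefficients remains. -/
theorem closed_sub (hP : P.IsSymm) (hP' : P'.IsSymm) (Γ : Matrix (Fin m) (Fin n) ℝ) :
    e.closed t P Γ - e.closed t P' Γ =
      lyap (e.A t + e.B t * Γ) (e.C t + e.D t * Γ) (P - P') := by
  simp only [closed, base, cross, gram, lyap, transpose_add, transpose_mul, transpose_transpose,
    hP.eq, hP'.eq, Matrix.mul_add, Matrix.add_mul, Matrix.mul_sub, Matrix.sub_mul, Matrix.mul_assoc]
  abel

theorem closed_eq_lyap_add (hP : P.IsSymm) (Γ : Matrix (Fin m) (Fin n) ℝ) :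
    e.closed t P Γ = lyap (e.A t + e.B t * Γ) (e.C t + e.D t * Γ) P + e.closed t 0 Γ := by
  have := e.closed_sub (t := t) hP isSymm_zero Γ
  rw [sub_zero] at this
  rw [← this, sub_add_cancel]

/-- A congruence of the block weight by the column `(1, Γ)`: one block inequality thus gives a
Lyapunov inequality for every feedback at once. -/
theorem add_closed_eq (h : Matrix (Fin n) (Fin n) ℝ) (Γ : Matrix (Fin m) (Fin n) ℝ) :
    h + e.closed t P Γ = (fromRows (1 : Matrix (Fin n) (Fin n) ℝ) Γ)ᵀ * fromBlocks (h + e.base t P) (e.cross t P)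
      (e.cross t P)ᵀ (e.gram t P) * fromRows (1 : Matrix (Fin n) (Fin n) ℝ) Γ := by
  rw [transpose_fromRows, fromCols_mul_fromBlocks, fromCols_mul_fromRows]
  simp only [closed, transpose_one, Matrix.one_mul, Matrix.mul_one, Matrix.add_mul]
  abel

theorem gram_eq_add : e.gram t P = e.gram t P' + (e.D t)ᵀ * (P - P') * e.D t := by
  simp only [gram, Matrix.mul_sub, Matrix.sub_mul]
  abel

theorem gram_posDef (h : (e.gram t P').PosDef) (hP : (P - P').PosSemidef) :
    (e.gram t P).PosDef := by
  rw [e.gram_eq_add (P' := P')]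
  exact h.add_posSemidef (hP.transpose_mul_mul _)

theorem closed_sub_ric_posSemidef (h : (e.gram t P).PosDef) (Γ : Matrix (Fin m) (Fin n) ℝ) :
    (e.closed t P Γ - e.ric t P).PosSemidef := by
  rw [e.closed_eq_ric_add h.isUnit h.posSemidef.isSymm, add_sub_cancel_left]
  exact h.posSemidef.transpose_mul_mul _

theorem closed_gain (h : (e.gram t P).PosDef) : e.closed t P (e.gain t P) = e.ric t P := by
  rw [e.closed_eq_ric_add h.isUnit h.posSemidef.isSymm]
  simp

end Algebra

section Continuity

variable {X : Type*} [TopologicalSpace X] {s : Set X} {τ : X → ℝ}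
  {P : X → Matrix (Fin n) (Fin n) ℝ} {Γ : X → Matrix (Fin m) (Fin n) ℝ}

theorem continuousOn_base (hτ : ContinuousOn τ s) (hm : MapsTo τ s (Icc 0 T))
    (hP : ContinuousOn P s) : ContinuousOn (fun x => e.base (τ x) (P x)) s := by
  have hA : ContinuousOn (fun x => e.A (τ x)) s := e.contA.comp hτ hm
  have hC : ContinuousOn (fun x => e.C (τ x)) s := e.contC.comp hτ hm
  have hQ : ContinuousOn (fun x => e.Q (τ x)) s := e.contQ.comp hτ hm
  unfold base
  fun_prop

theorem continuousOn_cross (hτ : ContinuousOn τ s) (hm : MapsTo τ s (Icc 0 T))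
    (hP : ContinuousOn P s) : ContinuousOn (fun x => e.cross (τ x) (P x)) s := by
  have hB : ContinuousOn (fun x => e.B (τ x)) s := e.contB.comp hτ hm
  have hC : ContinuousOn (fun x => e.C (τ x)) s := e.contC.comp hτ hm
  have hD : ContinuousOn (fun x => e.D (τ x)) s := e.contD.comp hτ hm
  have hS : ContinuousOn (fun x => e.S (τ x)) s := e.contS.comp hτ hm
  unfold cross
  fun_prop

theorem continuousOn_gram (hτ : ContinuousOn τ s) (hm : MapsTo τ s (Icc 0 T))
    (hP : ContinuousOn P s) : ContinuousOn (fun x => e.gram (τ x) (P x)) s := by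
  have hD : ContinuousOn (fun x => e.D (τ x)) s := e.contD.comp hτ hm
  have hR : ContinuousOn (fun x => e.R (τ x)) s := e.contR.comp hτ hm
  unfold gram
  fun_prop

theorem continuousOn_closed (hτ : ContinuousOn τ s) (hm : MapsTo τ s (Icc 0 T))
    (hP : ContinuousOn P s) (hΓ : ContinuousOn Γ s) :
    ContinuousOn (fun x => e.closed (τ x) (P x) (Γ x)) s := by
  have h1 := e.continuousOn_base hτ hm hP
  have h2 := e.continuousOn_cross hτ hm hP
  have h3 := e.continuousOn_gram hτ hm hP
  unfold closed
  fun_prop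

theorem continuousOn_gain (hτ : ContinuousOn τ s) (hm : MapsTo τ s (Icc 0 T))
    (hP : ContinuousOn P s) (hpd : ∀ x ∈ s, (e.gram (τ x) (P x)).PosDef) :
    ContinuousOn (fun x => e.gain (τ x) (P x)) s := by
  have h2 := e.continuousOn_cross hτ hm hP
  have h3 := continuousOn_matrix_inv (e.continuousOn_gram hτ hm hP) fun x hx => (hpd x hx).isUnit
  unfold gain
  fun_prop

end Continuity

/-- Under a common feedback the difference `P₁ - P₂` satisfies a Lyapunov inequality. -/
theorem comparison {P₁ P₂ p₁ p₂ : ℝ → Matrix (Fin n) (Fin n) ℝ} {Γ : ℝ → Matrix (Fin m) (Fin n) ℝ}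
    (hΓ : ContinuousOn Γ (Icc 0 T)) (h₁ : MemC1 T P₁ p₁) (h₂ : MemC1 T P₂ p₂)
    (h : ∀ t ∈ Icc 0 T, ((p₂ t + e.closed t (P₂ t) (Γ t)) -
      (p₁ t + e.closed t (P₁ t) (Γ t))).PosSemidef)
    (hterm : (P₁ T - P₂ T).PosSemidef) {t : ℝ} (ht : t ∈ Icc 0 T) : (P₁ t - P₂ t).PosSemidef := by
  have hA := e.contA
  have hB := e.contB
  have hC := e.contC
  have hD := e.contD
  refine posSemidef_of_lyapunov (F := fun t => e.A t + e.B t * Γ t)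
    (C := fun t => e.C t + e.D t * Γ t) (by fun_prop) (by fun_prop) (h₁.sub h₂)
    (fun s hs => ?_) hterm ht
  rw [← e.closed_sub (h₁.1 s hs) (h₂.1 s hs)]
  convert h s hs using 1
  abel

theorem exists_closed_solution (hT : 0 ≤ T) {Γ : ℝ → Matrix (Fin m) (Fin n) ℝ}
    (hΓ : ContinuousOn Γ (Icc 0 T)) {G : Matrix (Fin n) (Fin n) ℝ} (hG : G.IsSymm) :
    ∃ P : ℝ → Matrix (Fin n) (Fin n) ℝ, P T = G ∧
      MemC1 T P (fun t => -e.closed t (P t) (Γ t)) := by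
  have hA := e.contA
  have hB := e.contB
  have hC := e.contC
  have hD := e.contD
  obtain ⟨P, hPT, hP⟩ := exists_lyapunov_solution (F := fun t => e.A t + e.B t * Γ t)
    (C := fun t => e.C t + e.D t * Γ t) (N := fun t => e.closed t 0 (Γ t)) hT (by fun_prop)
    (by fun_prop) (e.continuousOn_closed continuousOn_id (mapsTo_id _) continuousOn_const hΓ)
    (fun t ht => e.closed_isSymm ht isSymm_zero _) hG
  refine ⟨P, hPT, hP.1, ?_, fun t ht i j => ?_⟩
  · exact (e.continuousOn_closed continuousOn_id (mapsTo_id _) hP.continuousOn hΓ).neg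
  · beta_reduce
    rw [e.closed_eq_lyap_add (hP.1 t ht)]
    exact hP.2.2 t ht i j

/-- A `C¹` solution of the Riccati equation on `[0,T]` with terminal value `G`. -/
def IsSolution (G : Matrix (Fin n) (Fin n) ℝ) (P : ℝ → Matrix (Fin n) (Fin n) ℝ) : Prop :=
  MemC1 T P (fun t => -e.ric t (P t)) ∧ P T = G ∧ ∀ t ∈ Icc 0 T, (e.gram t (P t)).PosDef

/-- Compare under the gain of `P₁`: it is exact for `P₁` and at best suboptimal for `P₂`. -/
theorem IsSolution.sub_posSemidef {e : RiccatiData n m T} {G : Matrix (Fin n) (Fin n) ℝ}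
    {P₁ P₂ : ℝ → Matrix (Fin n) (Fin n) ℝ} (h₁ : e.IsSolution G P₁) (h₂ : e.IsSolution G P₂)
    {t : ℝ} (ht : t ∈ Icc 0 T) : (P₁ t - P₂ t).PosSemidef := by
  refine e.comparison (e.continuousOn_gain continuousOn_id (mapsTo_id _) h₁.1.continuousOn
    fun t ht => h₁.2.2 t ht) h₁.1 h₂.1 (fun s hs => ?_) ?_ ht
  · simp only [id]
    rw [e.closed_gain (h₁.2.2 s hs), neg_add_cancel, sub_zero, neg_add_eq_sub]
    exact e.closed_sub_ric_posSemidef (h₂.2.2 s hs) _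
  · rw [h₁.2.1, h₂.2.1, sub_self]
    exact PosSemidef.zero

/-- By symmetry `P₁ - P₂` and its negative are both positive semidefinite, so the trace vanishes and
with it every entry. -/
theorem IsSolution.eqOn {e : RiccatiData n m T} {G : Matrix (Fin n) (Fin n) ℝ}
    {P₁ P₂ : ℝ → Matrix (Fin n) (Fin n) ℝ} (h₁ : e.IsSolution G P₁) (h₂ : e.IsSolution G P₂) :
    EqOn P₁ P₂ (Icc 0 T) := by
  intro t ht
  have h12 := h₁.sub_posSemidef h₂ ht
  have h21 := h₂.sub_posSemidef h₁ ht
  have htr : (P₁ t - P₂ t).trace = 0 := by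
    refine le_antisymm ?_ h12.trace_nonneg
    have := h21.trace_nonneg
    rw [← neg_sub, trace_neg] at this
    linarith
  ext i j
  have := abs_apply_le_trace h12 i j
  rw [htr, Matrix.sub_apply] at this
  exact sub_eq_zero.1 (abs_nonpos_iff.1 this)

end RiccatiData

/-! ### Existence above a subsolution by Newton iteration -/

namespace RiccatiData

variable {n m : ℕ} {T : ℝ} (e : RiccatiData n m T)

/-- `H` is a subsolution of the Riccati equation with terminal value `G`: the transformed weights
are positive semidefinite and the control weight is positive definite. -/
structure IsSubsolution (G : Matrix (Fin n) (Fin n) ℝ) (H h : ℝ → Matrix (Fin n) (Fin n) ℝ) :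
    Prop where
  memC1 : MemC1 T H h
  block : ∀ t ∈ Icc 0 T, (fromBlocks (h t + e.base t (H t)) (e.cross t (H t))
    (e.cross t (H t))ᵀ (e.gram t (H t))).PosSemidef
  gram : ∀ t ∈ Icc 0 T, (e.gram t (H t)).PosDef
  terminal : (G - H T).PosSemidef

namespace IsSubsolution

variable {e} {G : Matrix (Fin n) (Fin n) ℝ} {H h : ℝ → Matrix (Fin n) (Fin n) ℝ}

theorem isSymm_terminal (hT : 0 ≤ T) (hs : e.IsSubsolution G H h) : G.IsSymm := by
  simpa using hs.terminal.isSymm.add (hs.memC1.1 T ⟨hT, le_rfl⟩)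

theorem le_closed_solution (hs : e.IsSubsolution G H h) {P : ℝ → Matrix (Fin n) (Fin n) ℝ}
    {Γ : ℝ → Matrix (Fin m) (Fin n) ℝ} (hΓ : ContinuousOn Γ (Icc 0 T)) (hPT : P T = G)
    (hP : MemC1 T P (fun t => -e.closed t (P t) (Γ t))) {t : ℝ} (ht : t ∈ Icc 0 T) :
    (P t - H t).PosSemidef := by
  refine e.comparison hΓ hP hs.memC1 (fun s hs' => ?_) (hPT ▸ hs.terminal) ht
  rw [neg_add_cancel, sub_zero, add_closed_eq]
  exact (hs.block s hs').transpose_mul_mul _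

/-- Newton (quasi-linearization) iteration: a sequence decreasing in the Loewner order, each term
solving the Lyapunov equation closed by the optimal gain of the previous one. -/
theorem exists_iteration (hT : 0 ≤ T) (hs : e.IsSubsolution G H h) :
    ∃ P : ℕ → ℝ → Matrix (Fin n) (Fin n) ℝ, (∀ k, P k T = G) ∧
      (∀ k, ∀ t ∈ Icc 0 T, (P k t).IsSymm) ∧
      (∀ k, ∀ t ∈ Icc 0 T, (P k t - H t).PosSemidef) ∧
      (∀ k, ∀ t ∈ Icc 0 T, (P k t - P (k + 1) t).PosSemidef) ∧
      (∀ k, MemC1 T (P (k + 1)) (fun t => -e.closed t (P (k + 1) t) (e.gain t (P k t)))) ∧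
      ContinuousOn (P 0) (Icc 0 T) := by
  have hG := hs.isSymm_terminal hT
  -- Each iterate carries a continuous feedback generating it; this alone gives `P ≥ H`, hence a
  -- positive definite `gram` and a well-defined next gain.
  let Adm := {P : ℝ → Matrix (Fin n) (Fin n) ℝ // P T = G ∧ ∃ Γ : ℝ → Matrix (Fin m) (Fin n) ℝ,
    ContinuousOn Γ (Icc 0 T) ∧ MemC1 T P (fun t => -e.closed t (P t) (Γ t))}
  have hle : ∀ P : Adm, ∀ t ∈ Icc 0 T, (P.1 t - H t).PosSemidef := by
    rintro ⟨P, hPT, Γ, hΓ, hP⟩ t ht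
    exact hs.le_closed_solution hΓ hPT hP ht
  have hpd : ∀ P : Adm, ∀ t ∈ Icc 0 T, (e.gram t (P.1 t)).PosDef := fun P t ht =>
    e.gram_posDef (hs.gram t ht) (hle P t ht)
  have hgain : ∀ P : Adm, ContinuousOn (fun t => e.gain t (P.1 t)) (Icc 0 T) := by
    intro P
    obtain ⟨_, _, _, hP⟩ := P.2
    exact e.continuousOn_gain continuousOn_id (mapsTo_id _) hP.continuousOn (hpd P)
  have hnext : ∀ P : Adm, ∃ P' : Adm,
      MemC1 T P'.1 (fun t => -e.closed t (P'.1 t) (e.gain t (P.1 t))) := by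
    intro P
    obtain ⟨P', hP'T, hP'⟩ := e.exists_closed_solution hT (hgain P) hG
    exact ⟨⟨P', hP'T, _, hgain P, hP'⟩, hP'⟩
  choose next hnext using hnext
  obtain ⟨P₀, hP₀T, hP₀⟩ := e.exists_closed_solution hT (Γ := fun _ => 0) continuousOn_const hG
  let u : ℕ → Adm := fun k => next^[k] ⟨P₀, hP₀T, _, continuousOn_const, hP₀⟩
  have hu : ∀ k, u (k + 1) = next (u k) := fun k => Function.iterate_succ_apply' _ _ _
  have hstep : ∀ k, MemC1 T (u (k + 1)).1
      (fun t => -e.closed t ((u (k + 1)).1 t) (e.gain t ((u k).1 t))) := by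
    intro k
    rw [hu]
    exact hnext (u k)
  have hsymm : ∀ k, ∀ t ∈ Icc 0 T, ((u k).1 t).IsSymm := by
    intro k
    obtain ⟨_, _, _, hP⟩ := (u k).2
    exact hP.1
  refine ⟨fun k => (u k).1, fun k => (u k).2.1, hsymm, fun k => hle (u k), fun k t ht => ?_,
    hstep, hP₀.continuousOn⟩
  obtain ⟨hPT, Γ, hΓ, hP⟩ := (u k).2
  -- Both are compared under the gain of the current iterate, which is exact for the next one and no
  -- worse than the feedback `Γ` that produced the current one.
  refine e.comparison (hgain (u k)) hP (hstep k) (fun s hs' => ?_) ?_ ht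
  · rw [neg_add_cancel, zero_sub, neg_add, neg_neg, ← sub_eq_add_neg,
      e.closed_gain (hpd _ s hs')]
    exact e.closed_sub_ric_posSemidef (hpd _ s hs') _
  · rw [hPT, (u (k + 1)).2.1, sub_self]
    exact PosSemidef.zero

/-- Uniform bound for the right-hand sides of the Newton iteration. -/
theorem exists_closed_bound (hs : e.IsSubsolution G H h) {U : ℝ → Matrix (Fin n) (Fin n) ℝ}
    (hU : ContinuousOn U (Icc 0 T)) : ∃ M : ℝ, ∀ t ∈ Icc 0 T, ∀ P P' : Matrix (Fin n) (Fin n) ℝ,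
      (P - H t).PosSemidef → (U t - P).PosSemidef → (P' - H t).PosSemidef →
      (U t - P').PosSemidef → ∀ i j, |e.closed t P' (e.gain t P) i j| ≤ M := by
  have hH := hs.memC1.continuousOn
  -- The order interval from `H t` to `U t` is bounded: entries of `P - H t` are at most its trace,
  -- which is at most the trace of `U t - H t`.
  have hbox : ∃ c : ℝ, ∀ t ∈ Icc 0 T, ∀ P : Matrix (Fin n) (Fin n) ℝ, (P - H t).PosSemidef →
      (U t - P).PosSemidef → ∀ i j, P i j ∈ Icc (-c) c := by
    have htr : ContinuousOn (fun t => (U t - H t).trace) (Icc 0 T) :=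
      (continuous_id.matrix_trace).comp_continuousOn (hU.sub hH)
    obtain ⟨a, ha⟩ := isCompact_Icc.exists_bound_of_continuousOn htr
    obtain ⟨b, hb⟩ := isCompact_Icc.exists_bound_of_continuousOn
      (f := fun t (i j : Fin n) => H t i j) hH
    refine ⟨a + b, fun t ht P h1 h2 i j => abs_le.1 ?_⟩
    have h3 := abs_apply_le_trace h1 i j
    have h4 := h2.trace_nonneg
    have h5 : |H t i j| ≤ b :=
      ((norm_le_pi_norm _ j).trans (norm_le_pi_norm (fun i j => H t i j) i)).trans (hb t ht)
    have h6 := (le_abs_self _).trans (ha t ht)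
    have h7 := abs_add_le (P i j - H t i j) (H t i j)
    rw [sub_add_cancel] at h7
    rw [Matrix.sub_apply] at h3
    simp only [trace_sub] at h3 h4 h6
    linarith
  obtain ⟨c, hc⟩ := hbox
  let box : Set (Matrix (Fin n) (Fin n) ℝ) := Set.matrix (Icc (-c) c)
  have hboxc : IsCompact box := isCompact_Icc.matrix
  -- Keeping `P ≥ H t` in the compact set keeps `gram` invertible there, so the gain is continuous
  -- and the right-hand side bounded.
  let K : Set (ℝ × Matrix (Fin n) (Fin n) ℝ × Matrix (Fin n) (Fin n) ℝ) :=
    (Icc 0 T ×ˢ box ×ˢ box) ∩ (fun p => p.2.1 - H p.1) ⁻¹' {M | M.PosSemidef}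
  have hprod := (isCompact_Icc (a := 0) (b := T)).prod (hboxc.prod hboxc)
  have hP₁ : ∀ s : Set (ℝ × Matrix (Fin n) (Fin n) ℝ × Matrix (Fin n) (Fin n) ℝ),
      ContinuousOn (fun p => p.2.1) s := fun s => (continuous_fst.comp continuous_snd).continuousOn
  have hP₂ : ∀ s : Set (ℝ × Matrix (Fin n) (Fin n) ℝ × Matrix (Fin n) (Fin n) ℝ),
      ContinuousOn (fun p => p.2.2) s := fun s => (continuous_snd.comp continuous_snd).continuousOn
  have hK : IsCompact K := by
    refine hprod.of_isClosed_subset (ContinuousOn.preimage_isClosed_of_isClosed ?_ hprod.isClosed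
      isClosed_posSemidef) inter_subset_left
    exact (hP₁ _).sub (hH.comp continuousOn_fst fun p hp => hp.1)
  have hmaps : MapsTo (fun p => p.1) K (Icc 0 T) := fun p hp => hp.1.1
  have hgain := e.continuousOn_gain (continuousOn_fst (s := K)) hmaps (hP₁ K)
    fun p hp => e.gram_posDef (hs.gram p.1 hp.1.1) hp.2
  have hcont := e.continuousOn_closed continuousOn_fst hmaps (hP₂ K) hgain
  obtain ⟨M, hM⟩ := hK.exists_bound_of_continuousOn
    (f := fun p (i j : Fin n) => e.closed p.1 p.2.2 (e.gain p.1 p.2.1) i j) hcont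
  refine ⟨M, fun t ht P P' h1 h2 h3 h4 i j => ?_⟩
  exact ((norm_le_pi_norm _ j).trans (norm_le_pi_norm
    (fun i j => e.closed t P' (e.gain t P) i j) i)).trans
    (hM (t, P, P') ⟨⟨ht, fun i j => hc t ht P h1 h2 i j, fun i j => hc t ht P' h3 h4 i j⟩, h1⟩)

/-- The Newton iterates converge pointwise by monotonicity. Their derivatives are uniformly bounded,
so the limit is Lipschitz, and dominated convergence passes to the limit in the integral form of the
equation, which returns a `C¹` solution. -/
theorem exists_solution (hT : 0 < T) (hs : e.IsSubsolution G H h) :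
    ∃ P, e.IsSolution G P ∧ ∀ t ∈ Icc 0 T, (P t - H t).PosSemidef := by
  obtain ⟨X, hXT, hXs, hXH, hXX, hXd, hX0⟩ := hs.exists_iteration hT.le
  obtain ⟨M, hM⟩ := hs.exists_closed_bound hX0
  have hX0le : ∀ k, ∀ t ∈ Icc 0 T, (X 0 t - X k t).PosSemidef := by
    intro k t ht
    induction k with
    | zero => rw [sub_self]; exact PosSemidef.zero
    | succ k ih => simpa using ih.add (hXX k t ht)
  have hbound : ∀ k, ∀ t ∈ Icc 0 T, ∀ i j,
      |(-e.closed t (X (k + 1) t) (e.gain t (X k t))) i j| ≤ M := by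
    intro k t ht i j
    rw [Matrix.neg_apply, abs_neg]
    exact hM t ht _ _ (hXH k t ht) (hX0le k t ht) (hXH _ t ht) (hX0le _ t ht) i j
  -- The membership sits inside the existential so that the limit is a function on all of `ℝ`;
  -- outside `[0,T]` its value is irrelevant.
  have hlim : ∀ t, ∃ L, t ∈ Icc 0 T → Tendsto (fun k => X k t) atTop (𝓝 L) := by
    intro t
    by_cases ht : t ∈ Icc 0 T
    · obtain ⟨L, hL⟩ := exists_tendsto_of_antitone (fun k => hXs k t ht) (fun k => hXX k t ht)
        (fun k => hXH k t ht)
      exact ⟨L, fun _ => hL⟩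
    · exact ⟨0, fun h => absurd h ht⟩
  choose P hP using hlim
  have hPe : ∀ t ∈ Icc 0 T, ∀ i j, Tendsto (fun k => X (k + 1) t i j) atTop (𝓝 (P t i j)) :=
    fun t ht i j => tendsto_pi_nhds.1 (tendsto_pi_nhds.1
      ((tendsto_add_atTop_iff_nat 1).2 (hP t ht)) i) j
  have hPH : ∀ t ∈ Icc 0 T, (P t - H t).PosSemidef := fun t ht =>
    isClosed_posSemidef.mem_of_tendsto ((hP t ht).sub_const (H t))
      (Eventually.of_forall fun k => hXH k t ht)
  have hPs : ∀ t ∈ Icc 0 T, (P t).IsSymm := fun t ht => by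
    simpa using (hPH t ht).isSymm.add (hs.memC1.1 t ht)
  have hpd : ∀ t ∈ Icc 0 T, (e.gram t (P t)).PosDef := fun t ht =>
    e.gram_posDef (hs.gram t ht) (hPH t ht)
  have hcont : ContinuousOn P (Icc 0 T) := by
    refine continuousOn_matrix_of_elem fun i j => ?_
    have hM0 : 0 ≤ M := (abs_nonneg _).trans (hbound 0 0 ⟨le_rfl, hT.le⟩ i j)
    -- The iterates from the first on share the Lipschitz constant `M`, by the mean value
    -- inequality, and it passes to the limit.
    refine (LipschitzOnWith.of_dist_le_mul (K := ⟨M, hM0⟩) fun t ht s hs' => ?_).continuousOn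
    refine le_of_tendsto ((hPe t ht i j).dist (hPe s hs' i j)) (Eventually.of_forall fun k => ?_)
    rw [dist_eq_norm, dist_eq_norm]
    exact (convex_Icc 0 T).norm_image_sub_le_of_norm_hasDerivWithin_le
      (fun r hr => (hXd k).2.2 r hr i j) (fun r hr => hbound k r hr i j) hs' ht
  have hricc : ContinuousOn (fun t => -e.ric t (P t)) (Icc 0 T) := by
    refine ((e.continuousOn_closed continuousOn_id (mapsTo_id _) hcont
      (e.continuousOn_gain continuousOn_id (mapsTo_id _) hcont hpd)).neg).congr fun t ht => ?_
    simp only [id, Pi.neg_apply]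
    rw [e.closed_gain (hpd t ht)]
  have hrhs : ∀ t ∈ Icc 0 T, Tendsto
      (fun k => -e.closed t (X (k + 1) t) (e.gain t (X k t))) atTop (𝓝 (-e.ric t (P t))) := by
    intro t ht
    let s : Set (Matrix (Fin n) (Fin n) ℝ) := {Y | (Y - H t).PosSemidef}
    have hg : ContinuousOn (fun Y => e.gain t Y) s :=
      e.continuousOn_gain continuousOn_const (fun _ _ => ht) continuousOn_id
        fun Y hY => e.gram_posDef (hs.gram t ht) hY
    have h1 : Tendsto (fun k => e.gain t (X k t)) atTop (𝓝 (e.gain t (P t))) :=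
      (hg (P t) (hPH t ht)).tendsto.comp (tendsto_nhdsWithin_iff.2
        ⟨hP t ht, Eventually.of_forall fun k => hXH k t ht⟩)
    have h2 : Continuous fun p : Matrix (Fin n) (Fin n) ℝ × Matrix (Fin m) (Fin n) ℝ =>
        e.closed t p.1 p.2 :=
      continuousOn_univ.1 (e.continuousOn_closed (τ := fun _ => t) continuousOn_const
        (fun _ _ => ht) continuousOn_fst continuousOn_snd)
    rw [← e.closed_gain (hpd t ht)]
    exact ((h2.tendsto _).comp
      (((tendsto_add_atTop_iff_nat 1).2 (hP t ht)).prodMk_nhds h1)).neg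
  have hPT : P T = G := tendsto_nhds_unique (hP T ⟨hT.le, le_rfl⟩) (by simp [hXT])
  have hricsymm : ∀ t ∈ Icc 0 T, (-e.ric t (P t)).IsSymm := fun t ht => by
    rw [← e.closed_gain (hpd t ht)]
    exact (e.closed_isSymm ht (hPs t ht) _).neg
  refine ⟨P, ⟨MemLambda.memC1 ⟨⟨hricc, hricsymm⟩, hPs, fun t ht => ?_⟩, hPT, hpd⟩, hPH⟩
  have hsub : uIoc 0 t ⊆ Icc 0 T := by
    rw [uIoc_of_le ht.1]
    exact Ioc_subset_Icc_self.trans (Icc_subset_Icc_right ht.2)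
  ext i j
  rw [Matrix.add_apply, of_apply]
  have hDCT : Tendsto (fun k => ∫ s in (0 : ℝ)..t,
      (-e.closed s (X (k + 1) s) (e.gain s (X k s))) i j) atTop
      (𝓝 (∫ s in (0 : ℝ)..t, (-e.ric s (P s)) i j)) := by
    refine intervalIntegral.tendsto_integral_filter_of_dominated_convergence (fun _ => M)
      (Eventually.of_forall fun k => ?_) (Eventually.of_forall fun k => ?_)
      intervalIntegrable_const ?_
    · exact ((continuousOn_matrix_elem (hXd k).2.1 i j).mono hsub).aestronglyMeasurable
        measurableSet_uIoc
    · exact Eventually.of_forall fun s hs' => hbound k s (hsub hs') i j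
    · exact Eventually.of_forall fun s hs' =>
        tendsto_pi_nhds.1 (tendsto_pi_nhds.1 (hrhs s (hsub hs')) i) j
  refine tendsto_nhds_unique (hPe t ht i j)
    (((hPe 0 ⟨le_rfl, hT.le⟩ i j).add hDCT).congr fun k => ?_)
  rw [((hXd k).memLambda hT).2.2 t ht, Matrix.add_apply, of_apply]

end IsSubsolution

end RiccatiData

/-! ### From almost every time to every time, and block matrices -/

theorem Nonneg.posSemidef {ι : Type*} [Fintype ι] {T : ℝ} (hT : 0 < T) {f : ℝ → Matrix ι ι ℝ}
    (hf : ContinuousOn f (Icc 0 T)) (h : Nonneg T f) {t : ℝ} (ht : t ∈ Icc 0 T) :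
    (f t).PosSemidef := by
  refine posSemidef_iff_isSymm.2 ⟨?_, fun v => ?_⟩
  · ext i j
    exact Measure.eqOn_Icc_of_ae_eq volume hT.ne
      (h.mono fun s hs => hs.isSymm.apply i j)
      (continuousOn_matrix_elem hf j i) (continuousOn_matrix_elem hf i j) ht
  -- Nonnegativity is encoded as the equation `min _ 0 = 0`, so that almost-everywhere equality of
  -- continuous functions upgrades to equality everywhere.
  · have := Measure.eqOn_Icc_of_ae_eq volume hT.ne
      (f := fun s => min (v ⬝ᵥ (f s *ᵥ v)) 0) (g := fun _ => 0)
      (h.mono fun s hs => min_eq_right (hs.quad_nonneg v))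
      (ContinuousOn.inf (continuousOn_quad hf continuousOn_const) continuousOn_const) continuousOn_const ht
    exact min_eq_right_iff.1 this

theorem UnifPos.exists_posSemidef {ι : Type*} [Fintype ι] [DecidableEq ι] {T : ℝ} (hT : 0 < T)
    {f : ℝ → Matrix ι ι ℝ} (hf : ContinuousOn f (Icc 0 T)) (h : UnifPos T f) :
    ∃ δ : ℝ, 0 < δ ∧ ∀ t ∈ Icc 0 T, (f t - δ • (1 : Matrix ι ι ℝ)).PosSemidef := by
  obtain ⟨δ, hδ, h⟩ := h
  exact ⟨δ, hδ, fun t ht => h.posSemidef hT (hf.sub continuousOn_const) ht⟩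

theorem nonneg_of_forall {ι : Type*} [Fintype ι] {T : ℝ} {f : ℝ → Matrix ι ι ℝ}
    (h : ∀ t ∈ Icc 0 T, (f t).PosSemidef) : Nonneg T f :=
  ae_restrict_of_forall_mem measurableSet_Icc h

theorem posDef_of_sub_smul_one {ι : Type*} [Fintype ι] [DecidableEq ι] {M : Matrix ι ι ℝ} {δ : ℝ}
    (hδ : 0 < δ) (h : (M - δ • (1 : Matrix ι ι ℝ)).PosSemidef) : M.PosDef := by
  rw [← sub_add_cancel M (δ • (1 : Matrix ι ι ℝ))]
  exact PosDef.posSemidef_add h (PosDef.one.smul hδ)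

theorem UnifPos.posDef {ι : Type*} [Fintype ι] [DecidableEq ι] {T : ℝ} (hT : 0 < T)
    {f : ℝ → Matrix ι ι ℝ} (hf : ContinuousOn f (Icc 0 T)) (h : UnifPos T f) {t : ℝ}
    (ht : t ∈ Icc 0 T) : (f t).PosDef := by
  obtain ⟨δ, hδ, h⟩ := h.exists_posSemidef hT hf
  exact posDef_of_sub_smul_one hδ (h t ht)

theorem MemC1.congr_deriv {n : ℕ} {T : ℝ} {F f g : ℝ → Matrix (Fin n) (Fin n) ℝ}
    (h : MemC1 T F f) (hfg : EqOn g f (Icc 0 T)) : MemC1 T F g :=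
  ⟨h.1, h.2.1.congr hfg, fun t ht i j => hfg ht ▸ h.2.2 t ht i j⟩

theorem transpose_fromCols_mul_mul_fromCols {l ι κ : Type*} [Fintype l] (M : Matrix l l ℝ)
    (X : Matrix l ι ℝ) (Y : Matrix l κ ℝ) :
    (fromCols X Y)ᵀ * M * fromCols X Y =
      fromBlocks (Xᵀ * M * X) (Xᵀ * M * Y) (Yᵀ * M * X) (Yᵀ * M * Y) := by
  rw [transpose_fromCols, fromRows_mul, fromRows_mul_fromCols]

section Blocks

variable {ι κ : Type*} [Fintype ι] [Fintype κ] [DecidableEq ι] [DecidableEq κ]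

theorem posSemidef_fromBlocks_diagonal {M : Matrix ι ι ℝ} {N : Matrix κ κ ℝ}
    (hM : M.PosSemidef) (hN : N.PosSemidef) : (fromBlocks M 0 0 N).PosSemidef := by
  have h1 := hM.transpose_mul_mul (fromCols (1 : Matrix ι ι ℝ) (0 : Matrix ι κ ℝ))
  have h2 := hN.transpose_mul_mul (fromCols (0 : Matrix κ ι ℝ) (1 : Matrix κ κ ℝ))
  convert h1.add h2 using 1
  rw [transpose_fromCols_mul_mul_fromCols, transpose_fromCols_mul_mul_fromCols, fromBlocks_add]
  simp

end Blocks

namespace RiccatiData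

variable {n m : ℕ} {T : ℝ} (e : RiccatiData n m T)

/-- With `Ṗ = -ric P` the block weight is `(-gain, 1)ᵀ * gram * (-gain, 1)`, a congruence of a
positive definite matrix. -/
theorem block_ric_posSemidef {t : ℝ} {P : Matrix (Fin n) (Fin n) ℝ} (h : (e.gram t P).PosDef) :
    (fromBlocks (-e.ric t P + e.base t P) (e.cross t P) (e.cross t P)ᵀ
      (e.gram t P)).PosSemidef := by
  have h1 : e.gram t P * e.gain t P = -(e.cross t P)ᵀ := by
    rw [gain, Matrix.mul_neg,
      mul_nonsing_inv_cancel_left _ _ ((isUnit_iff_isUnit_det _).1 h.isUnit)]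
  have h2 : (e.gain t P)ᵀ * e.gram t P = -e.cross t P := by
    rw [← congrArg (fun M => (e.gain t P)ᵀ * M) h.posSemidef.isSymm.eq, ← transpose_mul, h1,
      transpose_neg, transpose_transpose]
  convert h.posSemidef.transpose_mul_mul (fromCols (-e.gain t P) (1 : Matrix (Fin m) (Fin m) ℝ))
    using 1
  rw [transpose_fromCols_mul_mul_fromCols]
  simp only [ric, transpose_neg, Matrix.neg_mul, Matrix.mul_neg, h1, h2, transpose_one,
    Matrix.one_mul, Matrix.mul_one, neg_neg, neg_sub, sub_add_cancel]

end RiccatiData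

/-! ### The coupled system as two single Riccati equations -/

namespace Data

variable {n m : ℕ} (d : Data n m)

/-- The data of the first Riccati equation. -/
def riccati : RiccatiData n m d.T where
  A := d.A
  B := d.B
  C := d.C
  D := d.D
  Q := d.Q
  S := d.S
  R := d.R
  contA := d.memA
  contB := d.memB
  contC := d.memC
  contD := d.memD
  contQ := d.memQ.1
  contS := d.memS
  contR := d.memR.1
  symmQ := d.memQ.2
  symmR := d.memR.2

theorem continuousOn_hatA : ContinuousOn d.hatA (Icc 0 d.T) := d.memA.add d.memA'
theorem continuousOn_hatB : ContinuousOn d.hatB (Icc 0 d.T) := d.memB.add d.memB'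
theorem continuousOn_hatC : ContinuousOn d.hatC (Icc 0 d.T) := d.memC.add d.memC'
theorem continuousOn_hatD : ContinuousOn d.hatD (Icc 0 d.T) := d.memD.add d.memD'
theorem continuousOn_hatQ : ContinuousOn d.hatQ (Icc 0 d.T) := d.memQ.1.add d.memQ'.1
theorem continuousOn_hatS : ContinuousOn d.hatS (Icc 0 d.T) := d.memS.add d.memS'
theorem continuousOn_hatR : ContinuousOn d.hatR (Icc 0 d.T) := d.memR.1.add d.memR'.1

theorem hatQ_isSymm {t : ℝ} (ht : t ∈ Icc 0 d.T) : (d.hatQ t).IsSymm :=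
  (d.memQ.2 t ht).add (d.memQ'.2 t ht)

theorem hatR_isSymm {t : ℝ} (ht : t ∈ Icc 0 d.T) : (d.hatR t).IsSymm :=
  (d.memR.2 t ht).add (d.memR'.2 t ht)

/-- The data of the second Riccati equation, `P` being a solution of the first one. -/
def hatRiccati {P : ℝ → Matrix (Fin n) (Fin n) ℝ} (hP : ContinuousOn P (Icc 0 d.T))
    (hPs : ∀ t ∈ Icc 0 d.T, (P t).IsSymm) : RiccatiData n m d.T where
  A := d.hatA
  B := d.hatB
  -- The noise coefficients of the second equation multiply only the known `P`, so they are absorbed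
  -- into the weights below.
  C := 0
  D := 0
  Q := fun t => (d.hatC t)ᵀ * P t * d.hatC t + d.hatQ t
  S := fun t => (d.hatC t)ᵀ * P t * d.hatD t + d.hatS t
  R := fun t => (d.hatD t)ᵀ * P t * d.hatD t + d.hatR t
  contA := d.continuousOn_hatA
  contB := d.continuousOn_hatB
  contC := continuousOn_const
  contD := continuousOn_const
  contQ := by
    have hC := d.continuousOn_hatC
    have hQ := d.continuousOn_hatQ
    fun_prop
  contS := by
    have hC := d.continuousOn_hatC
    have hD := d.continuousOn_hatD
    have hS := d.continuousOn_hatS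
    fun_prop
  contR := by
    have hD := d.continuousOn_hatD
    have hR := d.continuousOn_hatR
    fun_prop
  symmQ := fun t ht => by
    simp only [IsSymm, transpose_add, transpose_mul, transpose_transpose, (hPs t ht).eq,
      (d.hatQ_isSymm ht).eq, Matrix.mul_assoc]
  symmR := fun t ht => by
    simp only [IsSymm, transpose_add, transpose_mul, transpose_transpose, (hPs t ht).eq,
      (d.hatR_isSymm ht).eq, Matrix.mul_assoc]

section Formulas

variable {P : ℝ → Matrix (Fin n) (Fin n) ℝ} (hP : ContinuousOn P (Icc 0 d.T))
    (hPs : ∀ t ∈ Icc 0 d.T, (P t).IsSymm) (t : ℝ)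

theorem compQ_eq (H h : ℝ → Matrix (Fin n) (Fin n) ℝ) :
    d.compQ H h t = h t + d.riccati.base t (H t) := by
  simp only [compQ, RiccatiData.base, riccati, add_assoc]

theorem compHatQ_eq (K k : ℝ → Matrix (Fin n) (Fin n) ℝ) :
    d.compHatQ P K k t = k t + (d.hatRiccati hP hPs).base t (K t) := by
  simp [compHatQ, RiccatiData.base, hatRiccati, add_assoc]

theorem compHatS_eq (K : ℝ → Matrix (Fin n) (Fin n) ℝ) :
    d.compHatS P K t = (d.hatRiccati hP hPs).cross t (K t) := by
  simp [compHatS, RiccatiData.cross, hatRiccati, add_assoc]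

theorem compHatR_eq (K : Matrix (Fin n) (Fin n) ℝ) :
    d.compHatR P t = (d.hatRiccati hP hPs).gram t K := by
  simp [compHatR, RiccatiData.gram, hatRiccati]

theorem hatGam_eq (K : Matrix (Fin n) (Fin n) ℝ) :
    d.hatGam t (P t) K = (d.hatRiccati hP hPs).gain t K := by
  simp [hatGam, RiccatiData.gain, RiccatiData.gram, RiccatiData.cross, hatRiccati, add_assoc]

end Formulas

end Data

/-! ### Splitting the block-diagonal conditions -/

theorem UnifPos.fromBlocks_diagonal {ι κ : Type*} [Fintype ι] [Fintype κ] [DecidableEq ι]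
    [DecidableEq κ] {T : ℝ} {f : ℝ → Matrix ι ι ℝ} {g : ℝ → Matrix κ κ ℝ}
    (hf : UnifPos T f) (hg : UnifPos T g) :
    UnifPos T (fun t => fromBlocks (f t) 0 0 (g t)) := by
  obtain ⟨a, ha, hf⟩ := hf
  obtain ⟨b, hb, hg⟩ := hg
  refine ⟨min a b, lt_min ha hb, ?_⟩
  filter_upwards [hf, hg] with t h1 h2
  have h3 : (f t - min a b • (1 : Matrix ι ι ℝ)).PosSemidef := by
    convert h1.add (PosSemidef.one.smul (sub_nonneg.2 (min_le_left a b))) using 1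
    module
  have h4 : (g t - min a b • (1 : Matrix κ κ ℝ)).PosSemidef := by
    convert h2.add (PosSemidef.one.smul (sub_nonneg.2 (min_le_right a b))) using 1
    module
  convert posSemidef_fromBlocks_diagonal h3 h4 using 1
  rw [← fromBlocks_one, fromBlocks_smul, sub_eq_add_neg, fromBlocks_neg, fromBlocks_add]
  simp [sub_eq_add_neg]

theorem UnifPos.of_fromBlocks_diagonal {ι κ : Type*} [Fintype ι] [Fintype κ] [DecidableEq ι]
    [DecidableEq κ] {T : ℝ} {f : ℝ → Matrix ι ι ℝ} {g : ℝ → Matrix κ κ ℝ}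
    (h : UnifPos T (fun t => fromBlocks (f t) 0 0 (g t))) : UnifPos T f ∧ UnifPos T g := by
  obtain ⟨δ, hδ, h⟩ := h
  refine ⟨⟨δ, hδ, h.mono fun t ht => ?_⟩, ⟨δ, hδ, h.mono fun t ht => ?_⟩⟩
  · convert ht.submatrix Sum.inl using 1
    ext i j
    simp [one_apply]
  · convert ht.submatrix Sum.inr using 1
    ext i j
    simp [one_apply]

theorem continuousOn_fromBlocks {X l m n o : Type*} [TopologicalSpace X] {s : Set X}
    {a : X → Matrix n l ℝ} {b : X → Matrix n m ℝ} {c : X → Matrix o l ℝ} {d : X → Matrix o m ℝ}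
    (ha : ContinuousOn a s) (hb : ContinuousOn b s) (hc : ContinuousOn c s)
    (hd : ContinuousOn d s) :
    ContinuousOn (fun x => fromBlocks (a x) (b x) (c x) (d x)) s := by
  rw [continuousOn_iff_continuous_domRestrict] at *
  exact ha.matrix_fromBlocks hb hc hd

section DoubleBlocks

variable {ι κ : Type*} [Fintype ι] [Fintype κ] [DecidableEq ι] [DecidableEq κ]
  {q q' : Matrix ι ι ℝ} {s s' : Matrix ι κ ℝ} {r r' : Matrix κ κ ℝ}

/-- Regrouping the indices by subsystem turns the matrix into a block diagonal one; this decouples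
the compensator condition into one for each equation. -/
theorem posSemidef_doubleBlocks_iff :
    (fromBlocks (fromBlocks q 0 0 q') (fromBlocks s 0 0 s') (fromBlocks s 0 0 s')ᵀ
      (fromBlocks r 0 0 r')).PosSemidef ↔
    (fromBlocks q s sᵀ r).PosSemidef ∧ (fromBlocks q' s' s'ᵀ r').PosSemidef := by
  constructor
  · intro h
    constructor
    · convert h.submatrix (Sum.map Sum.inl Sum.inl) using 1
      ext (i | i) (j | j) <;> rfl
    · convert h.submatrix (Sum.map Sum.inr Sum.inr) using 1
      ext (i | i) (j | j) <;> rfl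
  · rintro ⟨h1, h2⟩
    convert (posSemidef_fromBlocks_diagonal h1 h2).submatrix (Equiv.sumSumSumComm ι ι κ κ) using 1
    ext ((i | i) | (i | i)) ((j | j) | (j | j)) <;> rfl

end DoubleBlocks

/-! ### Relaxed compensators versus Riccati solutions -/

namespace Data

variable {n m : ℕ} {d : Data n m} {P Ph : ℝ → Matrix (Fin n) (Fin n) ℝ}

/-- The control weight is monotone in `P`, so the constant `δ` for `H` also serves for `P`. -/
theorem unifPos_compR_of_le {H : ℝ → Matrix (Fin n) (Fin n) ℝ} (h : UnifPos d.T (d.compR H))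
    (hP : ∀ t ∈ Icc 0 d.T, (P t - H t).PosSemidef) : UnifPos d.T (d.compR P) := by
  obtain ⟨δ, hδ, h⟩ := h
  refine ⟨δ, hδ, ?_⟩
  filter_upwards [h, ae_restrict_mem measurableSet_Icc] with t h1 ht
  convert h1.add ((hP t ht).transpose_mul_mul (d.D t)) using 1
  simp only [compR, Matrix.mul_sub, Matrix.sub_mul]
  abel

theorem unifPos_compHatR_of_le {H : ℝ → Matrix (Fin n) (Fin n) ℝ}
    (h : UnifPos d.T (d.compHatR H))
    (hP : ∀ t ∈ Icc 0 d.T, (P t - H t).PosSemidef) : UnifPos d.T (d.compHatR P) := by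
  obtain ⟨δ, hδ, h⟩ := h
  refine ⟨δ, hδ, ?_⟩
  filter_upwards [h, ae_restrict_mem measurableSet_Icc] with t h1 ht
  convert h1.add ((hP t ht).transpose_mul_mul (d.hatD t)) using 1
  simp only [compHatR, Matrix.mul_sub, Matrix.sub_mul]
  abel

theorem continuousOn_compR (hP : ContinuousOn P (Icc 0 d.T)) :
    ContinuousOn (d.compR P) (Icc 0 d.T) :=
  d.riccati.continuousOn_gram continuousOn_id (mapsTo_id _) hP

theorem continuousOn_compHatR (hP : ContinuousOn P (Icc 0 d.T)) :
    ContinuousOn (d.compHatR P) (Icc 0 d.T) := by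
  have hD := d.continuousOn_hatD
  have hR := d.continuousOn_hatR
  unfold compHatR
  fun_prop

theorem IsRiccatiSolution.isSolution (h : d.IsRiccatiSolution P Ph) :
    d.riccati.IsSolution d.G P := by
  obtain ⟨p, ph, hP, hPh, heq, hPT, hR, heqh, hPhT, hRh⟩ := h
  refine ⟨hP.congr_deriv fun t ht => ?_, hPT, fun t ht =>
    hR.posDef d.T_pos (continuousOn_compR hP.continuousOn) ht⟩
  refine neg_eq_of_add_eq_zero_left ?_
  rw [← heq t ht]
  simp only [RiccatiData.ric, RiccatiData.base, riccati, add_assoc, add_sub_assoc]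
  rfl

/-- The auxiliary `P'`, equal to `P` only on `[0,T]`, lets two solutions of the system be read as
solutions of one and the same second equation, as uniqueness requires. -/
theorem IsRiccatiSolution.isSolution_hat (h : d.IsRiccatiSolution P Ph)
    {P' : ℝ → Matrix (Fin n) (Fin n) ℝ} (hP' : ContinuousOn P' (Icc 0 d.T))
    (hPs : ∀ t ∈ Icc 0 d.T, (P' t).IsSymm) (heqOn : EqOn P P' (Icc 0 d.T)) :
    (d.hatRiccati hP' hPs).IsSolution d.hatG Ph := by
  obtain ⟨p, ph, hP, hPh, heq, hPT, hR, heqh, hPhT, hRh⟩ := h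
  refine ⟨hPh.congr_deriv fun t ht => ?_, hPhT, fun t ht => ?_⟩
  · refine neg_eq_of_add_eq_zero_left ?_
    rw [← heqh t ht, heqOn ht, RiccatiData.ric, ← add_sub_assoc, ← compHatQ_eq, ← hatGam_eq,
      ← compHatR_eq]
    rfl
  · rw [← compHatR_eq, compHatR, ← heqOn ht]
    exact hRh.posDef d.T_pos (continuousOn_compHatR hP.continuousOn) ht

theorem isRiccatiSolution_of_isSolution (h : d.riccati.IsSolution d.G P)
    (hh : (d.hatRiccati h.1.continuousOn h.1.1).IsSolution d.hatG Ph)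
    (hR : UnifPos d.T (d.compR P)) (hRh : UnifPos d.T (d.compHatR P)) :
    d.IsRiccatiSolution P Ph := by
  refine ⟨_, _, h.1, hh.1, fun t ht => ?_, h.2.1, hR, fun t ht => ?_, hh.2.1, hRh⟩
  · rw [← neg_add_cancel (d.riccati.ric t (P t))]
    simp only [RiccatiData.ric, RiccatiData.base, riccati, add_assoc, add_sub_assoc]
    rfl
  · change d.compHatQ P Ph (fun s => -(d.hatRiccati h.1.continuousOn h.1.1).ric s (Ph s)) t -
      (d.hatGam t (P t) (Ph t))ᵀ * d.compHatR P t * d.hatGam t (P t) (Ph t) = 0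
    rw [d.compHatQ_eq h.1.continuousOn h.1.1, d.hatGam_eq h.1.continuousOn h.1.1,
      d.compHatR_eq h.1.continuousOn h.1.1 t (Ph t), add_sub_assoc]
    exact neg_add_cancel _

theorem IsRelaxedCompensator.exists_isRiccatiSolution {H K : ℝ → Matrix (Fin n) (Fin n) ℝ}
    (hc : d.IsRelaxedCompensator H K) : ∃ P Ph, d.IsRiccatiSolution P Ph := by
  obtain ⟨h, k, hH, hK, hblock, hR, hG⟩ := hc
  have hH1 := hH.memC1
  have hK1 := hK.memC1
  have hHc := hH1.continuousOn
  have hKc := hK1.continuousOn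
  obtain ⟨hRH, hRK⟩ := UnifPos.of_fromBlocks_diagonal hR
  have hblock1 : ∀ t ∈ Icc 0 d.T, (fromBlocks (h t + d.riccati.base t (H t))
      (d.riccati.cross t (H t)) (d.riccati.cross t (H t))ᵀ
      (d.riccati.gram t (H t))).PosSemidef := fun t ht => by
    refine Nonneg.posSemidef d.T_pos (f := fun t => fromBlocks (h t + d.riccati.base t (H t))
      (d.riccati.cross t (H t)) (d.riccati.cross t (H t))ᵀ (d.riccati.gram t (H t)))
      ?_ (hblock.mono fun t ht => ?_) ht
    · exact continuousOn_fromBlocks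
        (hH1.2.1.add (d.riccati.continuousOn_base continuousOn_id (mapsTo_id _) hHc))
        (d.riccati.continuousOn_cross continuousOn_id (mapsTo_id _) hHc)
        (continuousOn_matrix_transpose
          (d.riccati.continuousOn_cross continuousOn_id (mapsTo_id _) hHc))
        (d.riccati.continuousOn_gram continuousOn_id (mapsTo_id _) hHc)
    · beta_reduce
      rw [← compQ_eq]
      exact (posSemidef_doubleBlocks_iff.1 ht).1
  -- Formed with `H` as first component, since this is what the compensator condition controls; the
  -- passage to `P` comes later.
  set e := d.hatRiccati hHc hH1.1 with he
  have hblock2 : ∀ t ∈ Icc 0 d.T, (fromBlocks (k t + e.base t (K t))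
      (e.cross t (K t)) (e.cross t (K t))ᵀ (e.gram t (K t))).PosSemidef := fun t ht => by
    refine Nonneg.posSemidef d.T_pos (f := fun t => fromBlocks (k t + e.base t (K t))
      (e.cross t (K t)) (e.cross t (K t))ᵀ (e.gram t (K t))) ?_ (hblock.mono fun t ht => ?_) ht
    · exact continuousOn_fromBlocks
        (hK1.2.1.add (e.continuousOn_base continuousOn_id (mapsTo_id _) hKc))
        (e.continuousOn_cross continuousOn_id (mapsTo_id _) hKc)
        (continuousOn_matrix_transpose
          (e.continuousOn_cross continuousOn_id (mapsTo_id _) hKc))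
        (e.continuousOn_gram continuousOn_id (mapsTo_id _) hKc)
    · beta_reduce
      rw [he, ← compHatQ_eq, ← compHatS_eq, ← compHatR_eq]
      exact (posSemidef_doubleBlocks_iff.1 ht).2
  have hsub1 : d.riccati.IsSubsolution d.G H h :=
    ⟨hH1, hblock1, fun t ht => hRH.posDef d.T_pos (continuousOn_compR hHc) ht,
      hG.submatrix Sum.inl⟩
  obtain ⟨P, hP, hPH⟩ := hsub1.exists_solution d.T_pos
  have hR1 := unifPos_compR_of_le hRH hPH
  have hR2 := unifPos_compHatR_of_le hRK hPH
  have hsub2 : (d.hatRiccati hP.1.continuousOn hP.1.1).IsSubsolution d.hatG K k := by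
    refine ⟨hK1, fun t ht => ?_, fun t ht => ?_, hG.submatrix Sum.inr⟩
    -- Replacing `H` by `P` in the second block weight adds exactly the congruence of `P - H ≥ 0` by
    -- `(Ĉ, D̂)`.
    · convert (hblock2 t ht).add
        ((hPH t ht).transpose_mul_mul (fromCols (d.hatC t) (d.hatD t))) using 1
      rw [transpose_fromCols_mul_mul_fromCols, fromBlocks_add, he, ← compHatQ_eq, ← compHatS_eq,
        ← compHatR_eq, ← compHatQ_eq, ← compHatS_eq, ← compHatR_eq]
      have hs : (P t - H t)ᵀ = P t - H t := (hPH t ht).isSymm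
      have h1 : (d.compHatS P K t)  = d.compHatS H K t +
          (d.hatC t)ᵀ * (P t - H t) * d.hatD t := by
        simp only [compHatS, Matrix.mul_sub, Matrix.sub_mul]; abel
      have h2 : (d.hatD t)ᵀ * (P t - H t) * d.hatC t =
          ((d.hatC t)ᵀ * (P t - H t) * d.hatD t)ᵀ := by
        simp only [transpose_mul, transpose_transpose, hs, Matrix.mul_assoc]
      rw [h1, h2, transpose_add]
      congr 1
      · simp only [compHatQ, Matrix.mul_sub, Matrix.sub_mul]; abel
      · simp only [compHatR, Matrix.mul_sub, Matrix.sub_mul]; abel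
    · rw [← compHatR_eq]
      exact hR2.posDef d.T_pos (continuousOn_compHatR hP.1.continuousOn) ht
  obtain ⟨Ph, hPh, -⟩ := hsub2.exists_solution d.T_pos
  exact ⟨P, Ph, isRiccatiSolution_of_isSolution hP hPh hR1 hR2⟩

theorem IsRiccatiSolution.isRelaxedCompensator (h : d.IsRiccatiSolution P Ph) :
    d.IsRelaxedCompensator P Ph := by
  have h1 := h.isSolution
  have h2 := h.isSolution_hat h1.1.continuousOn h1.1.1 (eqOn_refl _ _)
  obtain ⟨_, _, _, _, _, _, hR, _, _, hRh⟩ := h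
  refine ⟨_, _, h1.1.memLambda d.T_pos, h2.1.memLambda d.T_pos, nonneg_of_forall fun t ht => ?_,
    UnifPos.fromBlocks_diagonal hR hRh, ?_⟩
  · rw [posSemidef_doubleBlocks_iff, compQ_eq, d.compHatQ_eq h1.1.continuousOn h1.1.1,
      d.compHatS_eq h1.1.continuousOn h1.1.1, d.compHatR_eq h1.1.continuousOn h1.1.1 t (Ph t)]
    exact ⟨d.riccati.block_ric_posSemidef (h1.2.2 t ht),
      RiccatiData.block_ric_posSemidef _ (h2.2.2 t ht)⟩
  · rw [compG, compHatG, h1.2.1, h2.2.1, sub_self, sub_self, fromBlocks_zero]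
    exact PosSemidef.zero

theorem IsRiccatiSolution.eqOn {P' Ph' : ℝ → Matrix (Fin n) (Fin n) ℝ}
    (h : d.IsRiccatiSolution P Ph) (h' : d.IsRiccatiSolution P' Ph') :
    EqOn P' P (Icc 0 d.T) ∧ EqOn Ph' Ph (Icc 0 d.T) := by
  have h1 := h.isSolution
  have heq := h'.isSolution.eqOn h1
  exact ⟨heq, (h'.isSolution_hat h1.1.continuousOn h1.1.1 heq).eqOn
    (h.isSolution_hat h1.1.continuousOn h1.1.1 (eqOn_refl _ _))⟩

end Data

end MFLQ

theorem corollary4p11 {n m : ℕ} (d : MFLQ.Data n m) :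
    (∃ H K : ℝ → Matrix (Fin n) (Fin n) ℝ, d.IsRelaxedCompensator H K) ↔
      d.HasUniqueRiccatiSolution := by
  constructor
  · rintro ⟨H, K, h⟩
    obtain ⟨P, Ph, hP⟩ := h.exists_isRiccatiSolution
    exact ⟨P, Ph, hP, fun P₁ Ph₁ h₁ => hP.eqOn h₁⟩
  · rintro ⟨P, Ph, hP, -⟩
    exact ⟨P, Ph, hP.isRelaxedCompensator⟩
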